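/- Let $I$ be a set (of indices of strictly non-commuting sources $j_i$, $i\in I$) and let $\mathbb K$ be a complete normed commutative ring (e.g. $\mathbb R$ or $\mathbb C$). Repeated indices are summed over. *Series.* A series $A[j]=\sum A_{i_1\cdots i_k}\,j_{i_1}\cdots j_{i_k}$ has coefficients in $\mathbb K$; products concatenate the sources, $A[0]$ is the constant coefficient. The planar derivative is given by $\frac{\partial}{\partial j_i}(c\,j_{i_1}\cdots j_{i_k})=c\,\delta_{ii_1}j_{i_2}\cdots j_{i_k}$ and $\frac{\partial}{\partial j_i}c=0$ for $c\in\mathbb K$, and $A[j]_{i_1\cdots i_k}:=\frac{\partial}{\partial j_{i_k}}\cdots\frac{\partial}{\partial j_{i_1}}A[j]$. *Trees.* A leaf of a planar rooted tree is a vertex without children (the one-vertex tree has one leaf); the other vertices are internal. A tree is reduced if no vertex has exactly one child. $\mathcal T^{red}_n$ is the finite set of reduced trees with $n$ leaves. The rightmost branch is the path from the root to the rightmost leaf. *Feynman rules.* Let $P_{xy}$ and $V_{a_1\cdots a_n}$ be a propagator and vertex functions. For a tree $T$ with $n-1$ leaves, attach the source $j_1$ to the root and $j_2,\dots,j_n$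 to the leaves from left to right. The amplitude of $T$ is the product of one factor $P$ for each edge and one for the source $j_1$ (index on the side of the root first) and of one factor $V$ for each internal vertex (leg towards the root first, then the legs towards the children from left to right), summed over all internal indices; for the one-vertex tree it is $P_{j_1j_2}$. *Data.* Let $G_F(x,y)$, $x,y\in I$, be the Feynman propagator and $\mathrm{AI}^{(n)}_{a_1\cdots a_n}$ ($n\ge 2$) the amputated planar 1PI Green's functions, without any symmetry assumption. Assume that for each $n$ only finitely many $\mathrm{AI}^{(n)}_{a_1\cdots a_n}$ are non-zero (automatic for finite $I$), so that all sums over repeated indices are finite, and that for all $x,y$ the sum of the amplitudes, for $P=G_F$ and $V=\mathrm{AI}$, over all planar rooted trees with one leaf (chains of 1PI two-point insertions) is absolutely convergent. For $n\ge2$ let $\mathrm W^{(n)}_{j_1\cdots j_n}$ be the sum over all (not necessarily reduced) planar rooted trees with $n-1$ leaves of the amplitudes for $P=G_F$, $V=\mathrm{AI}$, and let $\mathrm W[j]=\sum_{n\ge2}\mathrm W^{(n)}_{j_1\cdots j_n}\,j_1\cdots j_n$ (no tadpoles). Put $\Phi_i=\mathrm W[j]_i$ and $\Gamma[\Phi]_{a_1\cdots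 a_n}=\sum_{k\ge0}\mathrm{AI}^{(n+k)}_{a_1\cdots a_n i_1\cdots i_k}\Phi_{i_1}\cdots\Phi_{i_k}$; $\Gamma[0]$ and $\mathrm W[0]_{xy}$ are the constant coefficients of $\Gamma[\Phi]$ and $\mathrm W[j]_{xy}$. *The rule $F_\gamma$.* For a reduced tree $T$, $F_\gamma(T)$ is obtained from the amplitude of $T$ with $P=\mathrm W[0]$, $V=\Gamma[0]$ by replacing $\mathrm W[0]$ by $\mathrm W[j]$ and $\Gamma[0]$ by $\Gamma[\Phi]$ in the factors of the edges and internal vertices of the rightmost branch and in the factor of the source $j_1$, these non-commuting factors being multiplied from left to right in the order in which they are met on the way from the rightmost leaf to the root. The factors off the rightmost branch remain the $c$-numbers $\mathrm W[0]$, $\Gamma[0]$. For the one-vertex tree $F_\gamma=\mathrm W[j]_{j_1j_2}$. *Right growth.* $\mathfrak r_\bullet(T)$ is the formal sum of the trees obtained from $T$ by adding one new rightmost leaf in one of these ways: (a) the old root and the new leaf become the left and the right child of a new root; (b) the new leaf becomes the new rightmost child of an internal vertex of the rightmost branch; (c) an edge of the rightmost branch is split by a new vertex, whose left child is the end of the edge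 away from the root and whose right child is the new leaf. **Theorem.** All the series that define the $\mathrm W^{(n)}_{j_1\cdots j_n}$ converge absolutely, and: 1. for all $k\ge2$ and all sources $j_1,\dots,j_k$, $$\mathrm W[j]_{j_1\cdots j_k}=\sum_{T\in\mathcal T^{red}_{k-1}}F_\gamma(T);$$ 2. for all $k\ge2$, every $T\in\mathcal T^{red}_{k-1}$ and every source $j_{k+1}$, $\frac{\partial}{\partial j_{k+1}}F_\gamma(T)=F_\gamma(\mathfrak r_\bullet(T))$, with $F_\gamma$ extended additively and with $j_{k+1}$ attached to the new leaf; 3. for all $n\ge1$, each tree of $\mathcal T^{red}_{n+1}$ occurs exactly once in $\sum_{T\in\mathcal T^{red}_n}\mathfrak r_\bullet(T)$; hence $\frac{\partial}{\partial j_{k+1}}\mathrm W[j]_{j_1\cdots j_k}=\sum_{T\in\mathcal T^{red}_k}F_\gamma(T)$. -/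

import Mathlib

noncomputable section

namespace PlanarQFT

/-! ### Planar rooted trees -/

/-- Planar rooted trees: a root with the ordered (left to right) list of the subtrees of its
children. A leaf is a vertex without children, every other vertex is internal. The tree that
consists of one vertex is a tree with one leaf. -/
inductive PTree : Type
  | node (children : List PTree) : PTree

namespace PTree

/-- The tree with a single vertex. -/
def leaf : PTree := node []

mutual
/-- The number of leaves of a planar rooted tree. -/
def numLeaves : PTree → ℕ
  | node [] => 1
  | node (t :: ts) => numLeaves t + numLeavesForest ts
/-- The number of leaves of a forest. -/
def numLeavesForest : List PTree → ℕ
  | [] => 0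
  | t :: ts => numLeaves t + numLeavesForest ts
end

mutual
/-- A tree is reduced if no vertex has exactly one child. -/
def IsReduced : PTree → Prop
  | node ts => ts.length ≠ 1 ∧ IsReducedForest ts
/-- All the trees of the forest are reduced. -/
def IsReducedForest : List PTree → Prop
  | [] => True
  | t :: ts => IsReduced t ∧ IsReducedForest ts
end

mutual
/-- The right-growth operator. It adds one new leaf at the far right of the tree, in all the
following ways:
* the old root becomes the left child of a new root, whose right child is the new leaf;
* the new leaf is grafted, as a new rightmost child, to an internal vertex of the rightmost branch
  (the path from the root to the rightmost leaf);
* an edge of the rightmost branch is split by a new vertex, whose left child is the end of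
  the edge away from the root and whose right child is the new leaf.
In the recursion, splitting the edge from a vertex to its last child `t` appears as the first
operation, applied to the subtree `t`. -/
def growth : PTree → Multiset PTree
  | node [] => {node [leaf, leaf]}
  | node (t :: ts) =>
      {node [node (t :: ts), leaf]} + {node (t :: ts ++ [leaf])} + (growthLast (t :: ts)).map node
/-- Right-growth inside the last tree of a forest. -/
def growthLast : List PTree → Multiset (List PTree)
  | [] => 0
  | [t] => (growth t).map fun t' => [t']
  | t :: u :: ts => (growthLast (u :: ts)).map fun us => t :: us
end

theorem one_le_numLeaves : ∀ t : PTree, 1 ≤ numLeaves t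
  | node [] => le_of_eq (by simp [numLeaves])
  | node (t :: ts) => by
      have := one_le_numLeaves t
      simp only [numLeaves]
      omega

theorem length_le_numLeavesForest : ∀ ts : List PTree, ts.length ≤ numLeavesForest ts
  | [] => by simp
  | t :: ts => by
      have h1 := length_le_numLeavesForest ts
      have h2 := one_le_numLeaves t
      simp only [numLeavesForest, List.length_cons]
      omega

theorem numLeaves_le_forest {t : PTree} :
    ∀ {ts : List PTree}, t ∈ ts → numLeaves t + ts.length ≤ numLeavesForest ts + 1
  | u :: us, h => by
      have h1 := length_le_numLeavesForest us
      have h2 := one_le_numLeaves u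
      rcases List.mem_cons.1 h with rfl | h
      · simp only [numLeavesForest, List.length_cons]; omega
      · have := numLeaves_le_forest h
        simp only [numLeavesForest, List.length_cons]; omega

theorem isReduced_of_mem {t : PTree} :
    ∀ {ts : List PTree}, IsReducedForest ts → t ∈ ts → IsReduced t
  | u :: us, hr, h => by
      simp only [IsReducedForest] at hr
      rcases List.mem_cons.1 h with rfl | h
      · exact hr.1
      · exact isReduced_of_mem hr.2 h

theorem finite_reduced_le (n : ℕ) : {t : PTree | t.IsReduced ∧ t.numLeaves ≤ n}.Finite := by
  induction n with
  | zero =>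
    refine Set.Finite.subset Set.finite_empty ?_
    rintro t ⟨-, h⟩
    have := one_le_numLeaves t
    omega
  | succ n ih =>
    set S : Set PTree := {t : PTree | t.IsReduced ∧ t.numLeaves ≤ n} with hS
    have : Finite S := ih
    have hL : {l : List S | l.length ≤ n + 1}.Finite := List.finite_length_le S (n + 1)
    refine ((hL.image fun l => node (l.map Subtype.val)).union (Set.finite_singleton leaf)).subset ?_
    rintro ⟨ts⟩ ⟨hr, hn⟩
    simp only [IsReduced] at hr
    match ts, hr, hn with
    | [], _, _ => exact Or.inr rfl
    | [t], hr, _ => exact absurd rfl hr.1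
    | t :: u :: us, hr, hn =>
      left
      have hn' : numLeavesForest (t :: u :: us) ≤ n + 1 := by
        simpa only [numLeaves, numLeavesForest] using hn
      have hmem : ∀ v ∈ t :: u :: us, v ∈ S := by
        intro v hv
        refine ⟨isReduced_of_mem hr.2 hv, ?_⟩
        have := numLeaves_le_forest hv
        simp only [List.length_cons] at this
        omega
      have hlen := length_le_numLeavesForest (t :: u :: us)
      refine ⟨(t :: u :: us).attach.map fun v => ⟨v.1, hmem v.1 v.2⟩, ?_, ?_⟩
      · simp only [Set.mem_ofPred_eq, List.length_map, List.length_attach]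
        omega
      · simp only [List.map_map]
        congr 1
        exact List.attach_map_subtype_val _

/-- The finite set of the reduced planar rooted trees with `n` leaves. -/
def reducedTrees (n : ℕ) : Finset PTree :=
  Set.Finite.toFinset (s := {t : PTree | t.IsReduced ∧ t.numLeaves = n})
    ((finite_reduced_le n).subset fun _ h => ⟨h.1, h.2.le⟩)

end PTree

/-! ### Formal series in strictly non-commuting sources and planar functional calculus -/

/-- Formal series `∑ A_{i₁ ⋯ iₖ} j_{i₁} ⋯ j_{iₖ}` in strictly non-commuting sources `j_i`, `i : ι`:
the series `A` is the function that sends the word `[i₁, …, iₖ]` to the coefficient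
`A_{i₁ ⋯ iₖ}`. -/
def PlanarSeries (ι 𝕜 : Type*) : Type _ := List ι → 𝕜

namespace PlanarSeries

variable {ι 𝕜 : Type*}

instance [AddCommMonoid 𝕜] : AddCommMonoid (PlanarSeries ι 𝕜) :=
  inferInstanceAs (AddCommMonoid (List ι → 𝕜))

/-- The product of series: the sources are concatenated. -/
instance [Semiring 𝕜] : Mul (PlanarSeries ι 𝕜) :=
  ⟨fun A B w => ∑ n ∈ Finset.range (w.length + 1), A (w.take n) * B (w.drop n)⟩

/-- The series `c` without sources (a `c`-number). -/
def const [Zero 𝕜] (c : 𝕜) : PlanarSeries ι 𝕜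
  | [] => c
  | _ :: _ => 0

instance [Zero 𝕜] [One 𝕜] : One (PlanarSeries ι 𝕜) := ⟨const 1⟩

/-- `A[0]`, the value of the series when all the sources are set to `0`. -/
def atZero (A : PlanarSeries ι 𝕜) : 𝕜 := A []

/-- The planar functional derivative `∂/∂j_i`, that is the linear map with
`∂/∂j_i (c j_{i₁} ⋯ j_{iₖ}) = c δ_{i i₁} j_{i₂} ⋯ j_{iₖ}` and `∂/∂j_i c = 0`. -/
def deriv (i : ι) (A : PlanarSeries ι 𝕜) : PlanarSeries ι 𝕜 := fun w => A (i :: w)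

/-- The iterated derivative `A[j]_{i₁ ⋯ iₖ} = ∂/∂j_{iₖ} ⋯ ∂/∂j_{i₁} A[j]`. -/
def derivs (A : PlanarSeries ι 𝕜) (is : List ι) : PlanarSeries ι 𝕜 :=
  is.foldl (fun B i => deriv i B) A

/-- The coefficientwise sum of a family of series; it is used for the summation over repeated
indices. -/
def sumOver [AddCommMonoid 𝕜] {α : Type*} (f : α → PlanarSeries ι 𝕜) : PlanarSeries ι 𝕜 :=
  fun w => ∑ᶠ a, f a w

end PlanarSeries

open PlanarSeries PTree

variable {ι 𝕜 : Type*}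

/-! ### Feynman rules with values in the coefficients -/

section CNumber

variable [CommSemiring 𝕜]

mutual
/-- The amplitude of a tree for a propagator `P` and vertex functions `V`. The source at the root is
`x`; the sources at the leaves, from left to right, are the letters of `w`. There is one factor
`P` for each edge and one for the source at the root (index on the side of the root first), one
factor `V` for each internal vertex (index of the leg towards the root first, then those of the legs
towards the children, from left to right), and repeated indices are summed over. The tree with a
single vertex and the word `[y]` give `P x y`. -/
def treeAmp (P : ι → ι → 𝕜) (V : List ι → 𝕜) : PTree → ι → List ι → 𝕜
  | node [], x, [y] => P x y
  | node [], _, _ => 0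
  | node (t :: ts), x, w =>
      ∑ᶠ (x' : ι) (as : List ι), P x x' * V (x' :: as) * forestAmp P V (t :: ts) as w
/-- The product of the amplitudes of the trees of a forest, whose roots carry the indices `as`.
The trees read consecutive segments of the word `w`. (The value is `0` if the number of indices
is not that of the trees.) -/
def forestAmp (P : ι → ι → 𝕜) (V : List ι → 𝕜) : List PTree → List ι → List ι → 𝕜
  | [], [], _ => 1
  | [], _ :: _, _ => 0
  | _ :: _, [], _ => 0
  | t :: ts, a :: as, w =>
      treeAmp P V t a (w.take t.numLeaves) * forestAmp P V ts as (w.drop t.numLeaves)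
end

end CNumber

/-! ### Connected Green's functions and the Feynman rule `F_γ` -/

section Green

variable [NormedCommRing 𝕜]

/-- The generating functional `W[j]` of the planar connected Green's functions of the theory with
Feynman propagator `G` and amputated planar 1PI Green's functions `AI`: the `n`-point function
`W_{j₁ ⋯ jₙ}` is the sum of the amplitudes of all planar rooted trees with `n - 1` leaves, with the
source `j₁` at the root and the sources `j₂, …, jₙ` at the leaves. Vertices with a single child, which
carry the amputated 1PI two-point function, are allowed. -/
def connectedW (G : ι → ι → 𝕜) (AI : List ι → 𝕜) : PlanarSeries ι 𝕜
  | [] => 0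
  | x :: w => ∑' T : {T : PTree // T.numLeaves = w.length}, treeAmp G AI T.1 x w

/-- The field `Φ_i = ∂/∂j_i W[j]`. -/
def field (W : PlanarSeries ι 𝕜) (i : ι) : PlanarSeries ι 𝕜 := PlanarSeries.deriv i W

/-- The product `Φ_{i₁} ⋯ Φ_{iₖ}`. -/
def fieldProd (W : PlanarSeries ι 𝕜) : List ι → PlanarSeries ι 𝕜
  | [] => 1
  | i :: is => field W i * fieldProd W is

/-- `Γ[Φ]_{a₁ ⋯ aₙ} = ∑ AI_{a₁ ⋯ aₙ i₁ ⋯ iₖ} Φ_{i₁} ⋯ Φ_{iₖ}`, the sum over all words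
`i₁ ⋯ iₖ` of all lengths `k ≥ 0`. -/
def Gam (AI : List ι → 𝕜) (W : PlanarSeries ι 𝕜) (a : List ι) : PlanarSeries ι 𝕜 :=
  sumOver fun is : List ι => const (AI (a ++ is)) * fieldProd W is

/-- The `c`-number factors `W[0]` and `Γ[0]`, off the rightmost branch: the product over a tree
that hangs off this branch. -/
def shadowAmp (AI : List ι → 𝕜) (W : PlanarSeries ι 𝕜) : PTree → ι → List ι → 𝕜 :=
  treeAmp (fun x y => (W.derivs [x, y]).atZero) (fun a => (Gam AI W a).atZero)

mutual
/-- The Feynman rule `F_γ(T)`, for the source `x` at the root and the sources `w` at the leaves. It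
differs from the rule `treeAmp` with `W[0]` and `Γ[0]` in that the factors of the edges and internal
vertices of the rightmost branch (and of the source at the root) are the series `W[j]` and `Γ[Φ]`,
multiplied in the order in which they are met on the way from the rightmost leaf to the root. The
factors off the rightmost branch are the `c`-numbers `W[0]` and `Γ[0]`. -/
def Fgamma (AI : List ι → 𝕜) (W : PlanarSeries ι 𝕜) : PTree → ι → List ι → PlanarSeries ι 𝕜
  | node [], x, [y] => W.derivs [x, y]
  | node [], _, _ => const 0
  | node (t :: ts), x, w =>
      sumOver fun x' : ι => sumOver fun as : List ι =>
        FgammaForest AI W (t :: ts) as w * Gam AI W (x' :: as) * W.derivs [x, x']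
/-- The product of the contributions of the trees of a forest, whose roots carry the indices `as`:
`F_γ` for the last tree, `c`-numbers for the others. -/
def FgammaForest (AI : List ι → 𝕜) (W : PlanarSeries ι 𝕜) :
    List PTree → List ι → List ι → PlanarSeries ι 𝕜
  | [t], [a], w => Fgamma AI W t a w
  | t :: u :: ts, a :: as, w =>
      const (shadowAmp AI W t a (w.take t.numLeaves)) *
        FgammaForest AI W (u :: ts) as (w.drop t.numLeaves)
  | _, _, _ => const 0
end

end Green

end PlanarQFT

end

-- Everything rests on the planar Leibniz rule `deriv_mul`: a planar derivative sees only the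
-- leading source, so ∂(AB) = A[0] ∂B + (∂A) B. In `Fgamma` the factors are ordered from the
-- rightmost leaf to the root. A derivative that hits one of them therefore sets to zero sources all
-- factors nearer to that leaf. This is what happens to these factors when a new leaf is attached at
-- that point and takes over the rightmost branch.
--
-- Two local rules are needed. For vertices, ∂_i Γ_a = ∑ W_{bi} Γ_{ab} (`deriv_Gam`): the fields
-- have no constant coefficient, so only the first field of a product is differentiated, and a new
-- rightmost leg appears. For propagators, ∂_i W_{xy} = ∑ W_{cy}[0] W_{bi} Γ_{zcb} W_{xz}
-- (`deriv_derivs_pair`): the line is split by a three-point vertex. The second rule comes from the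
-- Dyson equation `connectedW_dyson`, obtained by cutting trees at the root. Both sides solve the
-- same linear equation X = S + (two-point insertion of X). Its solution is unique because iterating
-- the homogeneous equation produces amplitudes of longer and longer chains, which tend to zero as
-- terms of a convergent series.
--
-- Absolute convergence (`summable_norm_treeTerm`) is an induction on the number of sources.
-- Infinitely many trees arise only from vertices with a single child; a chain of these at the root
-- factors off as a one-leaf tree, and the branching below it has subtrees with fewer leaves.
--
-- The combinatorial claim holds because `prune` inverts growth on reduced trees and every reduced
-- tree except the single vertex is grown from a reduced one. Summing the Leibniz rule over all
-- trees then gives the formula for the derivatives of W by induction.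

noncomputable section

namespace PlanarQFT

open PlanarSeries PTree

-- Combinatorics of right-growth.

namespace PTree

theorem numLeavesForest_append (ts us : List PTree) :
    numLeavesForest (ts ++ us) = numLeavesForest ts + numLeavesForest us := by
  induction ts with
  | nil => simp [numLeavesForest]
  | cons t ts ih => simp only [List.cons_append, numLeavesForest, ih]; omega

theorem numLeaves_node {ts : List PTree} (h : ts ≠ []) :
    numLeaves (node ts) = numLeavesForest ts := by
  cases ts with
  | nil => exact absurd rfl h
  | cons t ts => simp only [numLeaves, numLeavesForest]

theorem numLeaves_leaf : numLeaves leaf = 1 := by simp only [leaf, numLeaves]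

theorem isReduced_leaf : IsReduced leaf := by simp [leaf, IsReduced, IsReducedForest]

theorem isReducedForest_iff {ts : List PTree} : IsReducedForest ts ↔ ∀ t ∈ ts, IsReduced t := by
  induction ts with
  | nil => simp [IsReducedForest]
  | cons t ts ih => simp [IsReducedForest, ih]

theorem growthLast_length {ts us : List PTree} (h : us ∈ growthLast ts) :
    us.length = ts.length := by
  induction ts generalizing us with
  | nil => simp [growthLast] at h
  | cons t ts ih =>
    cases ts with
    | nil =>
      simp only [growthLast, Multiset.mem_map] at h
      obtain ⟨t', -, rfl⟩ := h
      rfl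
    | cons u ts =>
      simp only [growthLast, Multiset.mem_map] at h
      obtain ⟨us, h, rfl⟩ := h
      simp [ih h]

theorem growthLast_ne_nil {ts us : List PTree} (hts : ts ≠ []) (h : us ∈ growthLast ts) :
    us ≠ [] := by
  rw [← List.length_pos_iff] at hts ⊢
  rwa [growthLast_length h]

theorem mem_growth_node {ts : List PTree} (h : ts ≠ []) {T : PTree} :
    T ∈ growth (node ts) ↔ T = node [node ts, leaf] ∨ T = node (ts ++ [leaf]) ∨
      ∃ us ∈ growthLast ts, node us = T := by
  cases ts with
  | nil => exact absurd rfl h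
  | cons t ts => simp [growth]

mutual
theorem numLeaves_of_mem_growth : ∀ (T : PTree) {T' : PTree}, T' ∈ growth T →
    numLeaves T' = numLeaves T + 1
  | node [], T', h => by
      simp only [growth, Multiset.mem_singleton] at h
      subst h
      simp [numLeaves, numLeavesForest, leaf]
  | node (t :: ts), T', h => by
      rw [mem_growth_node (by simp)] at h
      rcases h with rfl | rfl | ⟨us, h, rfl⟩
      · simp [numLeaves, numLeavesForest, leaf]
      · rw [numLeaves_node (by simp), numLeavesForest_append, numLeaves_node (by simp)]
        simp [numLeavesForest, numLeaves_leaf]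
      · rw [numLeaves_node (growthLast_ne_nil (by simp) h), numLeaves_node (by simp)]
        exact numLeavesForest_of_mem_growthLast (t :: ts) h
theorem numLeavesForest_of_mem_growthLast : ∀ (ts : List PTree) {us : List PTree},
    us ∈ growthLast ts → numLeavesForest us = numLeavesForest ts + 1
  | [], us, h => by simp [growthLast] at h
  | [t], us, h => by
      simp only [growthLast, Multiset.mem_map] at h
      obtain ⟨t', h, rfl⟩ := h
      have := numLeaves_of_mem_growth t h
      simp only [numLeavesForest]; omega
  | t :: u :: ts, us, h => by
      rw [growthLast] at h
      obtain ⟨vs, hvs, rfl⟩ := Multiset.mem_map.1 h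
      have := numLeavesForest_of_mem_growthLast (u :: ts) hvs
      simp only [numLeavesForest] at this ⊢; omega
end

mutual
theorem isReduced_of_mem_growth : ∀ (T : PTree) {T' : PTree}, IsReduced T → T' ∈ growth T →
    IsReduced T'
  | node [], T', _, h => by
      simp only [growth, Multiset.mem_singleton] at h
      subst h
      simp [IsReduced, IsReducedForest, isReduced_leaf]
  | node (t :: ts), T', hr, h => by
      rw [mem_growth_node (by simp)] at h
      have hr' := hr
      rw [IsReduced] at hr'
      rcases h with rfl | rfl | ⟨us, h, rfl⟩
      · rw [IsReduced, isReducedForest_iff]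
        simp [hr, isReduced_leaf]
      · rw [IsReduced, isReducedForest_iff]
        rw [isReducedForest_iff] at hr'
        refine ⟨by simp, fun u hu => ?_⟩
        rcases List.mem_append.1 hu with hu | hu
        · exact hr'.2 u hu
        · rw [List.mem_singleton.1 hu]; exact isReduced_leaf
      · rw [IsReduced, growthLast_length h]
        exact ⟨hr'.1, isReducedForest_of_mem_growthLast (t :: ts) hr'.2 h⟩
theorem isReducedForest_of_mem_growthLast : ∀ (ts : List PTree) {us : List PTree},
    IsReducedForest ts → us ∈ growthLast ts → IsReducedForest us
  | [], us, _, h => by simp [growthLast] at h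
  | [t], us, hr, h => by
      simp only [growthLast, Multiset.mem_map] at h
      obtain ⟨t', h, rfl⟩ := h
      rw [IsReducedForest] at hr ⊢
      exact ⟨isReduced_of_mem_growth t hr.1 h, hr.2⟩
  | t :: u :: ts, us, hr, h => by
      rw [growthLast] at h
      obtain ⟨vs, hvs, rfl⟩ := Multiset.mem_map.1 h
      rw [IsReducedForest] at hr ⊢
      exact ⟨hr.1, isReducedForest_of_mem_growthLast (u :: ts) hr.2 hvs⟩
end

mutual
/-- Removal of the rightmost leaf, followed by the removal of its parent if that vertex is left with
a single child. -/
def prune : PTree → PTree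
  -- Default value; the lemmas on pruning only concern trees with at least one edge.
  | node [] => leaf
  | node [t, node []] => t
  | node ts => node (pruneLast ts)
/-- Removal of the rightmost leaf of a forest. -/
def pruneLast : List PTree → List PTree
  | [] => []
  | [node []] => []
  | [node (t :: ts)] => [prune (node (t :: ts))]
  | t :: u :: ts => t :: pruneLast (u :: ts)
end

theorem pruneLast_append_leaf (ts : List PTree) : pruneLast (ts ++ [leaf]) = ts := by
  induction ts with
  | nil => simp [leaf, pruneLast]
  | cons t ts ih =>
    cases ts with
    | nil => simp [leaf, pruneLast]
    | cons u ts => simpa [pruneLast] using ih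

theorem ne_leaf_of_mem_growth {T T' : PTree} (h : T' ∈ growth T) : T' ≠ leaf := by
  rintro rfl
  have := numLeaves_of_mem_growth T h
  have := one_le_numLeaves T
  rw [numLeaves_leaf] at *
  omega

theorem pruneLast_singleton {T : PTree} (h : T ≠ leaf) : pruneLast [T] = [prune T] := by
  obtain ⟨ts⟩ := T
  cases ts with
  | nil => exact absurd rfl h
  | cons t ts => rw [pruneLast]

/-- A forest that arises from growth does not end with a leaf. -/
theorem growthLast_ne_append_leaf (ts us : List PTree) : us ++ [leaf] ∉ growthLast ts := by
  induction ts generalizing us with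
  | nil => simp [growthLast]
  | cons t ts ih =>
    cases ts with
    | nil =>
      intro h
      simp only [growthLast, Multiset.mem_map] at h
      obtain ⟨t', h, h'⟩ := h
      cases us with
      | nil => simp only [List.nil_append, List.cons.injEq, and_true] at h'
               exact ne_leaf_of_mem_growth h h'
      | cons u us => simp at h'
    | cons u ts =>
      intro h
      rw [growthLast] at h
      obtain ⟨vs, hvs, h'⟩ := Multiset.mem_map.1 h
      cases us with
      | nil =>
        simp only [List.nil_append, List.cons.injEq] at h'
        exact growthLast_ne_nil (by simp) hvs h'.2
      | cons v us =>
        simp only [List.cons_append, List.cons.injEq] at h'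
        exact ih us (h'.2 ▸ hvs)

theorem prune_node {ts : List PTree} (h0 : ts ≠ []) (h : ∀ t, ts ≠ [t, leaf]) :
    prune (node ts) = node (pruneLast ts) := by
  match ts, h0, h with
  | [t], _, _ => rw [prune] <;> simp
  | [t, node []], _, h => exact absurd rfl (h t)
  | [t, node (u :: us)], _, _ => rw [prune] <;> simp
  | t :: u :: v :: ts, _, _ => rw [prune] <;> simp

-- Reducedness is essential: `node [t, leaf]` arises both from `t` by a new root and from the
-- non-reduced `node [t]` by a new child, and pruning recovers only the former.
mutual
theorem prune_of_mem_growth : ∀ (T : PTree) {T' : PTree}, IsReduced T → T' ∈ growth T →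
    prune T' = T
  | node [], T', _, h => by
      simp only [growth, Multiset.mem_singleton] at h
      subst h
      simp [leaf, prune]
  | node (t :: ts), T', hr, h => by
      rw [mem_growth_node (by simp)] at h
      rw [IsReduced] at hr
      rcases h with rfl | rfl | ⟨us, h, rfl⟩
      · simp [leaf, prune]
      · rw [prune_node (by simp), pruneLast_append_leaf]
        intro u hu
        apply hr.1
        simpa using congrArg List.length hu
      · rw [prune_node (growthLast_ne_nil (by simp) h),
          pruneLast_of_mem_growthLast (t :: ts) hr.2 h]
        rintro u rfl
        exact growthLast_ne_append_leaf _ [u] h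
theorem pruneLast_of_mem_growthLast : ∀ (ts : List PTree) {us : List PTree},
    IsReducedForest ts → us ∈ growthLast ts → pruneLast us = ts
  | [], us, _, h => by simp [growthLast] at h
  | [t], us, hr, h => by
      simp only [growthLast, Multiset.mem_map] at h
      obtain ⟨t', h, rfl⟩ := h
      rw [IsReducedForest] at hr
      rw [pruneLast_singleton (ne_leaf_of_mem_growth h), prune_of_mem_growth t hr.1 h]
  | t :: u :: ts, us, hr, h => by
      rw [growthLast] at h
      obtain ⟨vs, hvs, rfl⟩ := Multiset.mem_map.1 h
      rw [IsReducedForest] at hr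
      have h1 := growthLast_ne_nil (by simp) hvs
      have h2 := pruneLast_of_mem_growthLast (u :: ts) hr.2 hvs
      cases vs with
      | nil => exact absurd rfl h1
      | cons v vs => rw [pruneLast, h2]
end

-- The list of children of the root tells the three kinds of growth apart. Growth inside the last
-- subtree never leaves a leaf as last child, the other two kinds always do, and these two differ in
-- the number of children because the old root does not have exactly one.
mutual
theorem nodup_growth : ∀ T : PTree, IsReduced T → (growth T).Nodup
  | node [], _ => by simp [growth]
  | node (t :: ts), hr => by
      rw [IsReduced] at hr
      have h := nodup_growthLast (t :: ts) hr.2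
      rw [growth, add_assoc, Multiset.singleton_add, Multiset.singleton_add, Multiset.nodup_cons,
        Multiset.nodup_cons]
      refine ⟨?_, ?_, h.map fun a b hab => by simpa using hab⟩
      · rw [Multiset.mem_cons, Multiset.mem_map, not_or]
        constructor
        · intro h
          apply hr.1
          have := congrArg List.length (PTree.node.inj h)
          simp only [List.length_append, List.length_cons, List.length_nil] at this ⊢
          omega
        · rintro ⟨us, h, h'⟩
          rw [PTree.node.inj h'] at h
          exact growthLast_ne_append_leaf _ [_] h
      · rw [Multiset.mem_map]
        rintro ⟨us, h, h'⟩
        rw [PTree.node.inj h'] at h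
        exact growthLast_ne_append_leaf _ _ h
theorem nodup_growthLast : ∀ ts : List PTree, IsReducedForest ts → (growthLast ts).Nodup
  | [], _ => by simp [growthLast]
  | [t], hr => by
      rw [IsReducedForest] at hr
      rw [growthLast]
      exact (nodup_growth t hr.1).map fun a b hab => by simpa using hab
  | t :: u :: ts, hr => by
      rw [IsReducedForest] at hr
      rw [growthLast]
      exact (nodup_growthLast (u :: ts) hr.2).map fun a b hab => by simpa using hab
end

-- The last child of the root decides. If it is a leaf, delete it: a single remaining child is
-- itself the tree to grow from, several remaining children stay below the root. Otherwise the
-- construction descends into the last child.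
mutual
theorem exists_mem_growth : ∀ T : PTree, IsReduced T → T ≠ leaf → ∃ S, IsReduced S ∧ T ∈ growth S
  | node [], _, h => absurd rfl h
  | node (t :: ts), hr, _ => by
      rw [IsReduced] at hr
      rcases exists_mem_growthLast (t :: ts) hr.2 (by simp) with ⟨us, hus⟩ | ⟨us, hus, hr', h⟩
      · have hr' : ∀ u ∈ us, IsReduced u := by
          rw [hus, isReducedForest_iff] at hr
          intro u hu
          exact hr.2 u (by simp [hu])
        match us, hus, hr' with
        | [], hus, _ => exact absurd (by rw [hus]; rfl) hr.1
        | [u], hus, hr' =>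
          refine ⟨u, hr' u (by simp), ?_⟩
          obtain ⟨vs⟩ := u
          rw [hus]
          cases vs with
          | nil => simp [growth, leaf]
          | cons v vs => simp [growth]
        | u :: v :: us, hus, hr' =>
          refine ⟨node (u :: v :: us), ?_, ?_⟩
          · rw [IsReduced, isReducedForest_iff]
            exact ⟨by simp, hr'⟩
          · rw [mem_growth_node (by simp), hus]
            simp
      · refine ⟨node us, ?_, ?_⟩
        · rw [IsReduced, ← growthLast_length h]
          exact ⟨hr.1, hr'⟩
        · rw [mem_growth_node hus]
          exact Or.inr (Or.inr ⟨_, h, rfl⟩)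
theorem exists_mem_growthLast : ∀ ts : List PTree, IsReducedForest ts → ts ≠ [] →
    (∃ us, ts = us ++ [leaf]) ∨ ∃ us, us ≠ [] ∧ IsReducedForest us ∧ ts ∈ growthLast us
  | [], _, h => absurd rfl h
  | [t], hr, _ => by
      rw [IsReducedForest] at hr
      by_cases h : t = leaf
      · exact Or.inl ⟨[], by rw [h]; rfl⟩
      · obtain ⟨S, hS, h⟩ := exists_mem_growth t hr.1 h
        refine Or.inr ⟨[S], by simp, by simpa [IsReducedForest] using hS, ?_⟩
        simpa [growthLast] using h
  | t :: u :: ts, hr, _ => by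
      rw [IsReducedForest] at hr
      rcases exists_mem_growthLast (u :: ts) hr.2 (by simp) with ⟨us, hus⟩ | ⟨us, hus, hr', h⟩
      · exact Or.inl ⟨t :: us, by rw [hus]; rfl⟩
      · refine Or.inr ⟨t :: us, by simp, by rw [IsReducedForest]; exact ⟨hr.1, hr'⟩, ?_⟩
        cases us with
        | nil => exact absurd rfl hus
        | cons v us => rw [growthLast]; exact Multiset.mem_map_of_mem _ h
end

theorem mem_reducedTrees {n : ℕ} {T : PTree} :
    T ∈ reducedTrees n ↔ IsReduced T ∧ numLeaves T = n := by
  simp [reducedTrees]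

theorem reducedTrees_one : reducedTrees 1 = {leaf} := by
  ext T
  rw [mem_reducedTrees, Finset.mem_singleton]
  constructor
  · rintro ⟨hr, h⟩
    by_contra hT
    obtain ⟨S, -, hS⟩ := exists_mem_growth T hr hT
    have h1 := numLeaves_of_mem_growth S hS
    have h2 := one_le_numLeaves S
    omega
  · rintro rfl
    exact ⟨isReduced_leaf, numLeaves_leaf⟩

/-- Right-growth creates each reduced tree with one more leaf exactly once. -/
theorem bind_growth_reducedTrees {n : ℕ} (hn : 1 ≤ n) :
    (reducedTrees n).val.bind growth = (reducedTrees (n + 1)).val := by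
  -- Neither side has repetitions, so comparing members suffices. On the left, a tree grown from two
  -- trees would prune back to both.
  refine (Multiset.Nodup.ext ?_ (reducedTrees (n + 1)).nodup).2 fun T => ?_
  · rw [Multiset.nodup_bind]
    refine ⟨fun T hT => nodup_growth T (mem_reducedTrees.1 hT).1, ?_⟩
    refine Multiset.Nodup.pairwise ?_ (reducedTrees n).nodup
    intro S hS S' hS' hne
    rw [Function.onFun, Multiset.disjoint_left]
    intro T h h'
    exact hne ((prune_of_mem_growth S (mem_reducedTrees.1 hS).1 h).symm.trans
      (prune_of_mem_growth S' (mem_reducedTrees.1 hS').1 h'))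
  · rw [Multiset.mem_bind, Finset.mem_val, mem_reducedTrees]
    constructor
    · rintro ⟨S, hS, h⟩
      obtain ⟨hr, hS⟩ := mem_reducedTrees.1 hS
      exact ⟨isReduced_of_mem_growth S hr h, by rw [numLeaves_of_mem_growth S h, hS]⟩
    · rintro ⟨hr, h⟩
      obtain ⟨S, hS, h'⟩ := exists_mem_growth T hr fun hT => by
        rw [hT, numLeaves_leaf] at h; omega
      have := numLeaves_of_mem_growth S h'
      exact ⟨S, mem_reducedTrees.2 ⟨hS, by omega⟩, h'⟩

end PTree

-- The semiring of non-commutative series and the planar Leibniz rule.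

namespace PlanarSeries

variable {ι 𝕜 α β : Type*}

@[ext]
theorem ext {A B : PlanarSeries ι 𝕜} (h : ∀ w, A w = B w) : A = B := funext h

theorem derivs_apply (A : PlanarSeries ι 𝕜) (u w : List ι) : A.derivs u w = A (u ++ w) := by
  induction u generalizing A with
  | nil => rfl
  | cons i u ih => exact ih (deriv i A)

theorem derivs_append (A : PlanarSeries ι 𝕜) (u v : List ι) :
    A.derivs (u ++ v) = (A.derivs u).derivs v := by
  ext w
  simp only [derivs_apply, List.append_assoc]

section Semiring

variable [CommSemiring 𝕜]

theorem add_apply (A B : PlanarSeries ι 𝕜) (w : List ι) : (A + B) w = A w + B w := rfl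

theorem zero_apply (w : List ι) : (0 : PlanarSeries ι 𝕜) w = 0 := rfl

theorem mul_apply (A B : PlanarSeries ι 𝕜) (w : List ι) :
    (A * B) w = ∑ n ∈ Finset.range (w.length + 1), A (w.take n) * B (w.drop n) := rfl

theorem mul_nil (A B : PlanarSeries ι 𝕜) : (A * B) [] = A [] * B [] := by simp [mul_apply]

theorem mul_cons (A B : PlanarSeries ι 𝕜) (i : ι) (w : List ι) :
    (A * B) (i :: w) = A [] * B (i :: w) + (deriv i A * B) w := by
  rw [mul_apply, List.length_cons, Finset.sum_range_succ']
  simp only [List.take_succ_cons, List.drop_succ_cons, List.take_zero, List.drop_zero]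
  rw [add_comm]
  rfl

theorem one_apply (w : List ι) : (1 : PlanarSeries ι 𝕜) w = const 1 w := rfl

theorem const_nil (c : 𝕜) : const (ι := ι) c [] = c := rfl

theorem const_cons (c : 𝕜) (i : ι) (w : List ι) : const c (i :: w) = 0 := rfl

theorem deriv_const (i : ι) (c : 𝕜) : deriv i (const c) = 0 := rfl

theorem deriv_add (i : ι) (A B : PlanarSeries ι 𝕜) : deriv i (A + B) = deriv i A + deriv i B := rfl

protected theorem add_mul' (A B C : PlanarSeries ι 𝕜) : (A + B) * C = A * C + B * C := by
  ext w; simp only [mul_apply, add_apply, add_mul, Finset.sum_add_distrib]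

protected theorem mul_add' (A B C : PlanarSeries ι 𝕜) : A * (B + C) = A * B + A * C := by
  ext w; simp only [mul_apply, add_apply, mul_add, Finset.sum_add_distrib]

protected theorem zero_mul' (A : PlanarSeries ι 𝕜) : 0 * A = 0 := by
  ext w; simp only [mul_apply, zero_apply, zero_mul, Finset.sum_const_zero]

protected theorem mul_zero' (A : PlanarSeries ι 𝕜) : A * 0 = 0 := by
  ext w; simp only [mul_apply, zero_apply, mul_zero, Finset.sum_const_zero]

theorem const_mul_apply (c : 𝕜) (A : PlanarSeries ι 𝕜) (w : List ι) :
    (const c * A : PlanarSeries ι 𝕜) w = c * A w := by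
  cases w with
  | nil => rw [mul_nil, const_nil]
  | cons i w => rw [mul_cons, deriv_const, PlanarSeries.zero_mul', zero_apply, add_zero, const_nil]

theorem mul_const_apply (c : 𝕜) (A : PlanarSeries ι 𝕜) (w : List ι) :
    (A * const c : PlanarSeries ι 𝕜) w = c * A w := by
  induction w generalizing A with
  | nil => rw [mul_nil, const_nil, mul_comm]
  | cons i w ih => rw [mul_cons, const_cons, mul_zero, zero_add, ih]; rfl

/-- The leading source of a product belongs to `A` unless `A` contributes its constant coefficient;
hence `B` is reached only through `A []`. -/
theorem deriv_mul (i : ι) (A B : PlanarSeries ι 𝕜) :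
    deriv i (A * B) = const (A []) * deriv i B + deriv i A * B := by
  ext w
  rw [add_apply, const_mul_apply]
  exact mul_cons A B i w

protected theorem mul_assoc' (A B C : PlanarSeries ι 𝕜) : A * B * C = A * (B * C) := by
  ext w
  induction w generalizing A B C with
  | nil => simp only [mul_nil, mul_assoc]
  | cons i w ih =>
    rw [mul_cons, mul_cons A, mul_cons B, deriv_mul, PlanarSeries.add_mul', add_apply, ih, ih,
      const_mul_apply, mul_nil]
    ring

instance : Semiring (PlanarSeries ι 𝕜) where
  __ := (inferInstance : AddCommMonoid (PlanarSeries ι 𝕜))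
  mul A B := A * B
  one := 1
  left_distrib := PlanarSeries.mul_add'
  right_distrib := PlanarSeries.add_mul'
  zero_mul := PlanarSeries.zero_mul'
  mul_zero := PlanarSeries.mul_zero'
  mul_assoc := PlanarSeries.mul_assoc'
  one_mul A := by
    ext w
    exact (const_mul_apply 1 A w).trans (one_mul _)
  mul_one A := by
    ext w
    exact (mul_const_apply 1 A w).trans (one_mul _)

theorem const_zero : const (0 : 𝕜) = (0 : PlanarSeries ι 𝕜) := by
  ext w; cases w <;> rfl

theorem const_mul_const (c d : 𝕜) : const c * const d = (const (c * d) : PlanarSeries ι 𝕜) := by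
  ext w
  rw [const_mul_apply]
  cases w with
  | nil => rfl
  | cons i w => exact mul_zero c

theorem mul_const_comm (c : 𝕜) (A : PlanarSeries ι 𝕜) : A * const c = const c * A := by
  ext w
  rw [const_mul_apply, mul_const_apply]

theorem deriv_zero (i : ι) : deriv i (0 : PlanarSeries ι 𝕜) = 0 := rfl

/-- The planar derivative as an additive map. -/
def derivHom (i : ι) : PlanarSeries ι 𝕜 →+ PlanarSeries ι 𝕜 where
  toFun := deriv i
  map_zero' := rfl
  map_add' _ _ := rfl

theorem deriv_const_mul (i : ι) (c : 𝕜) (A : PlanarSeries ι 𝕜) :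
    deriv i (const c * A) = const c * deriv i A := by
  rw [deriv_mul, deriv_const, zero_mul, add_zero, const_nil]

/-! ### Locally finite families -/

/-- Each coefficient vanishes for all but finitely many members of the family. -/
def LocFin (f : α → PlanarSeries ι 𝕜) : Prop :=
  ∀ w, Function.HasFiniteSupport fun a => f a w

/-- A word has finitely many splittings, and for each of them `f` alone restricts the index to a
finite set; `g` may be arbitrary. -/
theorem LocFin.mul_left {f : α → PlanarSeries ι 𝕜} (hf : LocFin f) (g : α → PlanarSeries ι 𝕜) :
    LocFin fun a => g a * f a := by
  intro w
  refine Set.Finite.subset ((Finset.range (w.length + 1)).finite_toSet.biUnion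
    fun n _ => hf (w.drop n)) fun a ha => ?_
  obtain ⟨n, hn, h⟩ := Finset.exists_ne_zero_of_sum_ne_zero (f := fun n =>
    g a (w.take n) * f a (w.drop n)) ha
  exact Set.mem_biUnion (Finset.mem_coe.2 hn) (right_ne_zero_of_mul h)

theorem LocFin.mul_right {f : α → PlanarSeries ι 𝕜} (hf : LocFin f) (g : α → PlanarSeries ι 𝕜) :
    LocFin fun a => f a * g a := by
  intro w
  refine Set.Finite.subset ((Finset.range (w.length + 1)).finite_toSet.biUnion
    fun n _ => hf (w.take n)) fun a ha => ?_
  obtain ⟨n, hn, h⟩ := Finset.exists_ne_zero_of_sum_ne_zero (f := fun n =>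
    f a (w.take n) * g a (w.drop n)) ha
  exact Set.mem_biUnion (Finset.mem_coe.2 hn) (left_ne_zero_of_mul h)

theorem LocFin.deriv {f : α → PlanarSeries ι 𝕜} (hf : LocFin f) (i : ι) :
    LocFin fun a => deriv i (f a) := fun w => hf (i :: w)

theorem locFin_const {f : α → 𝕜} (hf : Function.HasFiniteSupport f) :
    LocFin fun a => const (ι := ι) (f a) := by
  intro w
  cases w with
  | nil => exact hf
  | cons i w => exact Set.Finite.subset Set.finite_empty fun a ha => ha rfl

theorem LocFin.add {f g : α → PlanarSeries ι 𝕜} (hf : LocFin f) (hg : LocFin g) :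
    LocFin fun a => f a + g a := fun w =>
  ((hf w).union (hg w)).subset fun a ha => by
    by_contra h
    simp only [Set.mem_union, Function.mem_support, not_or, not_not] at h
    exact ha ((add_apply _ _ _).trans (by rw [h.1, h.2, add_zero]))

theorem LocFin.comp {f : α → PlanarSeries ι 𝕜} (hf : LocFin f) {g : β → α}
    (hg : Function.Injective g) : LocFin fun b => f (g b) :=
  fun w => (hf w).preimage hg.injOn

theorem sumOver_apply (f : α → PlanarSeries ι 𝕜) (w : List ι) : sumOver f w = ∑ᶠ a, f a w := rfl

theorem deriv_sumOver (i : ι) (f : α → PlanarSeries ι 𝕜) :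
    deriv i (sumOver f) = sumOver fun a => deriv i (f a) := rfl

theorem sumOver_add {f g : α → PlanarSeries ι 𝕜} (hf : LocFin f) (hg : LocFin g) :
    sumOver (fun a => f a + g a) = sumOver f + sumOver g := by
  ext w
  exact finsum_add_distrib (hf w) (hg w)

theorem mul_sumOver {f : α → PlanarSeries ι 𝕜} (hf : LocFin f) (A : PlanarSeries ι 𝕜) :
    A * sumOver f = sumOver fun a => A * f a := by
  ext w
  simp only [mul_apply, sumOver_apply]
  rw [finsum_sum_comm]
  · exact Finset.sum_congr rfl fun n _ => mul_finsum' _ _ (hf _)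
  · exact fun n _ => (hf (w.drop n)).subset fun a ha => right_ne_zero_of_mul ha

theorem sumOver_mul {f : α → PlanarSeries ι 𝕜} (hf : LocFin f) (A : PlanarSeries ι 𝕜) :
    sumOver f * A = sumOver fun a => f a * A := by
  ext w
  simp only [mul_apply, sumOver_apply]
  rw [finsum_sum_comm]
  · exact Finset.sum_congr rfl fun n _ => finsum_mul' _ _ (hf _)
  · exact fun n _ => (hf (w.take n)).subset fun a ha => left_ne_zero_of_mul ha

theorem sumOver_curry {f : α → β → PlanarSeries ι 𝕜} (hf : LocFin fun p : α × β => f p.1 p.2) :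
    sumOver (fun a => sumOver fun b => f a b) = sumOver fun p : α × β => f p.1 p.2 := by
  ext w
  exact (finsum_curry (fun p : α × β => f p.1 p.2 w) (hf w)).symm

theorem sumOver_comp_injective {f : α → PlanarSeries ι 𝕜} {g : β → α} (hg : Function.Injective g)
    (h : ∀ a, a ∉ Set.range g → f a = 0) : sumOver f = sumOver fun b => f (g b) := by
  ext w
  simp only [sumOver_apply]
  rw [← finsum_mem_range (f := fun a => f a w) hg]
  refine finsum_congr fun a => ?_
  by_cases ha : a ∈ Set.range g
  · simp [ha]
  · simp [ha, h a ha, zero_apply]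

theorem sumOver_comm {f : α → β → PlanarSeries ι 𝕜} (hf : LocFin fun p : α × β => f p.1 p.2) :
    sumOver (fun a => sumOver fun b => f a b) = sumOver fun b => sumOver fun a => f a b := by
  have hf' := hf.comp (g := Prod.swap (α := β)) Prod.swap_injective
  rw [sumOver_curry hf, sumOver_curry (f := fun b a => f a b) hf']
  exact sumOver_comp_injective Prod.swap_injective
    fun a ha => absurd (Prod.swap_surjective a) ha

theorem LocFin.multiset_sum {m : Multiset β} {f : β → α → PlanarSeries ι 𝕜}
    (hf : ∀ b ∈ m, LocFin (f b)) : LocFin fun a => (m.map fun b => f b a).sum := by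
  induction m using Multiset.induction_on with
  | empty => exact fun w => Set.Finite.subset Set.finite_empty fun a ha => ha rfl
  | cons b m ih =>
    simp only [Multiset.map_cons, Multiset.sum_cons]
    exact (hf b (by simp)).add (ih fun c hc => hf c (by simp [hc]))

theorem sumOver_multiset_sum {m : Multiset β} {f : β → α → PlanarSeries ι 𝕜}
    (hf : ∀ b ∈ m, LocFin (f b)) :
    sumOver (fun a => (m.map fun b => f b a).sum) = (m.map fun b => sumOver (f b)).sum := by
  induction m using Multiset.induction_on with
  | empty =>
    ext w
    exact finsum_zero
  | cons b m ih =>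
    have h : ∀ c ∈ m, LocFin (f c) := fun c hc => hf c (by simp [hc])
    simp only [Multiset.map_cons, Multiset.sum_cons]
    rw [sumOver_add (hf b (by simp)) (.multiset_sum h), ih h]

end Semiring

end PlanarSeries

variable {ι 𝕜 : Type*}

/-! ### Amplitudes as finite sums -/

section Amplitudes

variable [CommSemiring 𝕜]

theorem forestAmp_of_length_ne (P : ι → ι → 𝕜) (V : List ι → 𝕜) {ts : List PTree} {as : List ι}
    (h : as.length ≠ ts.length) (w : List ι) : forestAmp P V ts as w = 0 := by
  induction ts generalizing as w with
  | nil =>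
    cases as with
    | nil => exact absurd rfl h
    | cons a as => simp only [forestAmp]
  | cons t ts ih =>
    cases as with
    | nil => simp only [forestAmp]
    | cons a as =>
      rw [forestAmp, ih (by simpa using h), mul_zero]

theorem finite_vertex {V : List ι → 𝕜} (hV : ∀ n : ℕ, {a : List ι | a.length = n ∧ V a ≠ 0}.Finite)
    (n : ℕ) : {p : ι × List ι | p.2.length ≤ n ∧ V (p.1 :: p.2) ≠ 0}.Finite := by
  -- The full word `p.1 :: p.2` has up to `n + 1` letters, hence `n + 2` in the range.
  have h : (⋃ m ∈ Finset.range (n + 2), {a : List ι | a.length = m ∧ V a ≠ 0}).Finite :=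
    (Finset.range (n + 2)).finite_toSet.biUnion fun m _ => hV m
  refine (h.preimage (f := fun p : ι × List ι => p.1 :: p.2) ?_).subset ?_
  · rintro ⟨x, as⟩ - ⟨y, bs⟩ - h
    simpa using h
  · rintro ⟨x, as⟩ ⟨h1, h2⟩
    simp only [Set.mem_preimage, Set.mem_iUnion]
    refine ⟨as.length + 1, ?_, by simp, h2⟩
    rw [Finset.mem_range]
    simp only at h1
    omega

theorem hasFiniteSupport_vertex {V : List ι → 𝕜}
    (hV : ∀ n : ℕ, {a : List ι | a.length = n ∧ V a ≠ 0}.Finite) {f : ι × List ι → 𝕜} (n : ℕ)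
    (hf : ∀ p, f p ≠ 0 → p.2.length ≤ n ∧ V (p.1 :: p.2) ≠ 0) : Function.HasFiniteSupport f :=
  (finite_vertex hV n).subset fun p hp => hf p hp

theorem hasFiniteSupport_node (P : ι → ι → 𝕜) {V : List ι → 𝕜}
    (hV : ∀ n : ℕ, {a : List ι | a.length = n ∧ V a ≠ 0}.Finite) (ts : List PTree) (x : ι)
    (w : List ι) : Function.HasFiniteSupport fun p : ι × List ι =>
      P x p.1 * V (p.1 :: p.2) * forestAmp P V ts p.2 w := by
  refine hasFiniteSupport_vertex hV ts.length fun p hp => ?_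
  refine ⟨le_of_eq ?_, right_ne_zero_of_mul (left_ne_zero_of_mul hp)⟩
  by_contra h
  exact right_ne_zero_of_mul hp (forestAmp_of_length_ne P V h w)

theorem treeAmp_node (P : ι → ι → 𝕜) {V : List ι → 𝕜}
    (hV : ∀ n : ℕ, {a : List ι | a.length = n ∧ V a ≠ 0}.Finite) {ts : List PTree} (hts : ts ≠ [])
    (x : ι) (w : List ι) : treeAmp P V (node ts) x w =
      ∑ᶠ p : ι × List ι, P x p.1 * V (p.1 :: p.2) * forestAmp P V ts p.2 w := by
  cases ts with
  | nil => exact absurd rfl hts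
  | cons t ts =>
    rw [treeAmp]
    exact (finsum_curry _ (hasFiniteSupport_node P hV (t :: ts) x w)).symm

/-- The amplitude of a tree, set to `0` if the number of leaves is not the number of sources. -/
def treeTerm (P : ι → ι → 𝕜) (V : List ι → 𝕜) (x : ι) (w : List ι) (T : PTree) : 𝕜 :=
  if numLeaves T = w.length then treeAmp P V T x w else 0

/-- The amplitude of a forest, set to `0` if the number of leaves is not the number of sources. -/
def forestTerm (P : ι → ι → 𝕜) (V : List ι → 𝕜) (as w : List ι) (ts : List PTree) : 𝕜 :=
  if numLeavesForest ts = w.length then forestAmp P V ts as w else 0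

/-- The amplitude of the one-vertex tree. -/
def leafAmp (P : ι → ι → 𝕜) (x : ι) : List ι → 𝕜
  | [y] => P x y
  | _ => 0

theorem treeTerm_leaf (P : ι → ι → 𝕜) (V : List ι → 𝕜) (x : ι) (w : List ι) :
    treeTerm P V x w leaf = leafAmp P x w := by
  rw [treeTerm, numLeaves_leaf]
  match w with
  | [] => rfl
  | [y] => simp [leaf, treeAmp, leafAmp]
  | y :: z :: w => simp [leafAmp]

theorem treeTerm_nil (P : ι → ι → 𝕜) (V : List ι → 𝕜) (x : ι) (T : PTree) :
    treeTerm P V x [] T = 0 := by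
  have := one_le_numLeaves T
  rw [treeTerm, if_neg]
  simp only [List.length_nil]
  omega

theorem forestTerm_of_length_ne (P : ι → ι → 𝕜) (V : List ι → 𝕜) {ts : List PTree} {as : List ι}
    (h : as.length ≠ ts.length) (w : List ι) : forestTerm P V as w ts = 0 := by
  rw [forestTerm, forestAmp_of_length_ne P V h, ite_self]

theorem forestTerm_of_lt (P : ι → ι → 𝕜) (V : List ι → 𝕜) {as w : List ι}
    (h : w.length < as.length) (ts : List PTree) : forestTerm P V as w ts = 0 := by
  by_cases h' : as.length = ts.length
  · have := length_le_numLeavesForest ts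
    rw [forestTerm, if_neg (by omega)]
  · exact forestTerm_of_length_ne P V h' w

theorem forestTerm_nil (P : ι → ι → 𝕜) (V : List ι → 𝕜) (w : List ι) (ts : List PTree) :
    forestTerm P V [] w ts = if ts = [] then const 1 w else 0 := by
  cases ts with
  | nil => cases w <;> simp [forestTerm, forestAmp, numLeavesForest, const]
  | cons t ts => rw [forestTerm_of_length_ne P V (by simp), if_neg (by simp)]

/-- Only the splitting after `numLeaves t` letters contributes. With the extension by zero the
splittings no longer depend on the trees, so the sum over forests becomes a product of series. -/
theorem forestTerm_cons_cons (P : ι → ι → 𝕜) (V : List ι → 𝕜) (a : ι) (as w : List ι) (t : PTree)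
    (ts : List PTree) : forestTerm P V (a :: as) w (t :: ts) =
      ∑ n ∈ Finset.range (w.length + 1),
        treeTerm P V a (w.take n) t * forestTerm P V as (w.drop n) ts := by
  by_cases h : numLeaves t ≤ w.length
  · rw [Finset.sum_eq_single_of_mem (numLeaves t) (by rw [Finset.mem_range]; omega)]
    · rw [treeTerm, if_pos (by rw [List.length_take]; omega), forestTerm, forestTerm, forestAmp,
        numLeavesForest, List.length_drop]
      by_cases h' : numLeavesForest ts = w.length - numLeaves t
      · rw [if_pos h', if_pos (by omega)]
      · rw [if_neg h', if_neg (by omega), mul_zero]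
    · intro n hn hne
      rw [Finset.mem_range] at hn
      rw [treeTerm, if_neg (by rw [List.length_take]; omega), zero_mul]
  · rw [forestTerm, if_neg (by rw [numLeavesForest]; omega), Finset.sum_eq_zero]
    intro n hn
    rw [treeTerm, if_neg (by rw [List.length_take]; omega), zero_mul]

/-- `S` only has to contain the contributing indices, so one finite set can serve all trees and the
sum over trees can be exchanged with it. -/
theorem treeTerm_node (P : ι → ι → 𝕜) {V : List ι → 𝕜}
    (hV : ∀ n : ℕ, {a : List ι | a.length = n ∧ V a ≠ 0}.Finite) {ts : List PTree} (hts : ts ≠ [])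
    (x : ι) (w : List ι) {S : Finset (ι × List ι)}
    (hS : ∀ p : ι × List ι, V (p.1 :: p.2) ≠ 0 → forestTerm P V p.2 w ts ≠ 0 → p ∈ S) :
    treeTerm P V x w (node ts) =
      ∑ p ∈ S, P x p.1 * V (p.1 :: p.2) * forestTerm P V p.2 w ts := by
  rw [treeTerm, numLeaves_node hts]
  by_cases h : numLeavesForest ts = w.length
  · simp only [forestTerm, if_pos h] at hS ⊢
    rw [treeAmp_node P hV hts]
    refine finsum_eq_sum_of_support_subset _ fun p hp => ?_
    exact hS p (right_ne_zero_of_mul (left_ne_zero_of_mul hp)) (right_ne_zero_of_mul hp)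
  · simp only [forestTerm, if_neg h, mul_zero, Finset.sum_const_zero]

theorem forestTerm_singleton (P : ι → ι → 𝕜) (V : List ι → 𝕜) (a : ι) (w : List ι) (t : PTree) :
    forestTerm P V [a] w [t] = treeTerm P V a w t := by
  rw [forestTerm, treeTerm, numLeavesForest, numLeavesForest, add_zero]
  by_cases h : numLeaves t = w.length
  · rw [if_pos h, if_pos h, forestAmp, forestAmp, mul_one, h, List.take_length]
  · rw [if_neg h, if_neg h]

theorem treeTerm_unary (P : ι → ι → 𝕜) {V : List ι → 𝕜}
    (hV : ∀ n : ℕ, {a : List ι | a.length = n ∧ V a ≠ 0}.Finite) (t : PTree) (x : ι) (w : List ι)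
    {S : Finset (ι × ι)} (hS : ∀ p : ι × ι, V [p.1, p.2] ≠ 0 → p ∈ S) :
    treeTerm P V x w (node [t]) =
      ∑ p ∈ S, P x p.1 * V [p.1, p.2] * treeTerm P V p.2 w t := by
  let e : ι × ι ↪ ι × List ι := ⟨fun p => (p.1, [p.2]), by rintro ⟨a, b⟩ ⟨c, d⟩; simp⟩
  rw [treeTerm_node P hV (by simp) x w (S := S.map e), Finset.sum_map]
  · simp only [← forestTerm_singleton]
    rfl
  · rintro ⟨a, as⟩ h1 h2
    match as, h1, h2 with
    | [], _, h2 => exact absurd (forestTerm_of_length_ne P V (by simp) w) h2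
    | [b], h1, _ => exact Finset.mem_map_of_mem e (hS (a, b) h1)
    | b :: c :: as, _, h2 => exact absurd (forestTerm_of_length_ne P V (by simp) w) h2

end Amplitudes

/-! ### Chains of vertices with a single child -/

namespace PTree

/-- The tree with `m` vertices with a single child below the root of `T`. -/
def chain : ℕ → PTree → PTree
  | 0, T => T
  | m + 1, T => node [chain m T]

theorem numLeaves_chain (m : ℕ) (T : PTree) : numLeaves (chain m T) = numLeaves T := by
  induction m with
  | zero => rfl
  | succ m ih => rw [chain, numLeaves_node (by simp), numLeavesForest, numLeavesForest, ih, add_zero]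

theorem chain_leaf_injective : Function.Injective fun m => chain m leaf := by
  intro m n
  induction m generalizing n with
  | zero => cases n <;> simp [chain, leaf]
  | succ m ih =>
    cases n with
    | zero => simp [chain, leaf]
    | succ n =>
      intro h
      simp only [chain, node.injEq, List.cons.injEq, and_true] at h
      rw [ih h]

/-- Strips all consecutive single-child vertices at the root; a single vertex or a branching
remains. -/
theorem exists_chain : ∀ T : PTree, ∃ s : ℕ × List PTree, chain s.1 (node s.2) = T ∧ s.2.length ≠ 1
  | node [] => ⟨(0, []), rfl, by simp⟩
  | node [t] => by
      obtain ⟨⟨m, us⟩, h1, h2⟩ := exists_chain t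
      exact ⟨(m + 1, us), by simp only [chain, h1], h2⟩
  | node (t :: u :: ts) => ⟨(0, t :: u :: ts), rfl, by simp⟩

end PTree

/-- The chain, together with the line into the vertex below it, is a one-leaf tree whose leaf
carries that vertex's index `p.1`. The hypothesis on one-leaf trees thus applies to it. -/
theorem treeTerm_chain [CommSemiring 𝕜] (P : ι → ι → 𝕜) {V : List ι → 𝕜}
    (hV : ∀ n : ℕ, {a : List ι | a.length = n ∧ V a ≠ 0}.Finite) {ts : List PTree} (hts : ts ≠ [])
    (w : List ι) {S : Finset (ι × List ι)}
    (hS : ∀ p : ι × List ι, V (p.1 :: p.2) ≠ 0 → forestTerm P V p.2 w ts ≠ 0 → p ∈ S)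
    (m : ℕ) (x : ι) : treeTerm P V x w (chain m (node ts)) =
      ∑ p ∈ S, treeTerm P V x [p.1] (chain m leaf) * V (p.1 :: p.2) * forestTerm P V p.2 w ts := by
  induction m generalizing x with
  | zero =>
    simp only [chain, treeTerm_leaf]
    exact treeTerm_node P hV hts x w hS
  | succ m ih =>
    have hfin : {p : ι × ι | V [p.1, p.2] ≠ 0}.Finite := by
      refine ((hV 2).preimage (f := fun p : ι × ι => [p.1, p.2]) ?_).subset fun p hp => ⟨rfl, hp⟩
      rintro ⟨a, b⟩ - ⟨c, d⟩ - h
      simpa using h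
    have hQ : ∀ p : ι × ι, V [p.1, p.2] ≠ 0 → p ∈ hfin.toFinset := by simp
    simp only [chain, treeTerm_unary P hV _ x _ hQ, ih, Finset.mul_sum, Finset.sum_mul]
    rw [Finset.sum_comm]
    exact Finset.sum_congr rfl fun p _ => Finset.sum_congr rfl fun q _ => by ring

/-! ### Absolute convergence -/

section Summability

variable [NormedCommRing 𝕜]

theorem summable_subtype_treeTerm_iff (G : ι → ι → 𝕜) (AI : List ι → 𝕜) (x : ι) (w : List ι) :
    (Summable fun T : {T : PTree // T.numLeaves = w.length} => ‖treeAmp G AI T.1 x w‖) ↔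
      Summable fun T => ‖treeTerm G AI x w T‖ := by
  have h := summable_subtype_iff_indicator (f := fun T => ‖treeAmp G AI T x w‖)
    (s := {T : PTree | T.numLeaves = w.length})
  refine Iff.trans h (summable_congr fun T => ?_)
  by_cases hT : T.numLeaves = w.length <;> simp [treeTerm, hT]

theorem connectedW_cons (G : ι → ι → 𝕜) (AI : List ι → 𝕜) (x : ι) (w : List ι) :
    connectedW G AI (x :: w) = ∑' T, treeTerm G AI x w T := by
  refine (tsum_subtype {T : PTree | T.numLeaves = w.length}
    fun T => treeAmp G AI T x w).trans (tsum_congr fun T => ?_)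
  by_cases hT : T.numLeaves = w.length <;> simp [treeTerm, hT]

theorem connectedW_singleton (G : ι → ι → 𝕜) (AI : List ι → 𝕜) (x : ι) :
    connectedW G AI [x] = 0 := by
  rw [connectedW_cons]
  simp only [treeTerm_nil, tsum_zero]

theorem cons_pair_injective :
    Function.Injective fun p : PTree × List PTree => p.1 :: p.2 := by
  rintro ⟨t, ts⟩ ⟨u, us⟩ h
  simpa using h

theorem nil_of_notMem_range_cons {ts : List PTree}
    (h : ts ∉ Set.range fun p : PTree × List PTree => p.1 :: p.2) : ts = [] := by
  cases ts with
  | nil => rfl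
  | cons t ts => exact absurd ⟨(t, ts), rfl⟩ h

theorem summable_norm_forestTerm_nil (G : ι → ι → 𝕜) (AI : List ι → 𝕜) (w : List ι) :
    Summable fun ts => ‖forestTerm G AI [] w ts‖ := by
  refine summable_of_hasFiniteSupport ((Set.finite_singleton []).subset fun ts h => ?_)
  by_contra h'
  exact h (by simp only [forestTerm_nil, if_neg (show ¬ ts = [] from h'), norm_zero])

/-- Each of the other trees consumes at least one source, so one tree reads at most `w.length + 1 -
as.length` of them. With two or more trees this is less than `w.length`, which drives the induction
on sources. -/
theorem summable_norm_forestTerm (G : ι → ι → 𝕜) (AI : List ι → 𝕜) (as w : List ι)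
    (h : ∀ (a : ι) (v : List ι), v.length + as.length ≤ w.length + 1 →
      Summable fun T => ‖treeTerm G AI a v T‖) :
    Summable fun ts => ‖forestTerm G AI as w ts‖ := by
  induction as generalizing w with
  | nil => exact summable_norm_forestTerm_nil G AI w
  | cons a as ih =>
    rw [← cons_pair_injective.summable_iff]
    · simp only [Function.comp_def, forestTerm_cons_cons]
      refine Summable.of_nonneg_of_le (fun _ => norm_nonneg _) (fun p => norm_sum_le _ _)
        (summable_sum fun n hn => ?_)
      rw [Finset.mem_range] at hn
      simp only [List.length_cons] at h
      -- Splittings that leave no source for the head tree, or too few for the remaining trees,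
      -- contribute zero.
      by_cases h0 : n = 0
      · subst h0
        simp only [List.take_zero, treeTerm_nil, zero_mul, norm_zero]
        exact summable_zero
      by_cases h1 : w.length < n + as.length
      · simp only [forestTerm_of_lt G AI (show (w.drop n).length < as.length by
          rw [List.length_drop]; omega), mul_zero, norm_zero]
        exact summable_zero
      · refine Summable.mul_norm (h a _ ?_) (ih _ fun b v hv => h b v ?_)
        · rw [List.length_take]; omega
        · rw [List.length_drop] at hv; omega
    · intro ts hts
      rw [nil_of_notMem_range_cons hts, forestTerm_of_length_ne G AI (by simp), norm_zero]

variable {AI : List ι → 𝕜}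
  (hfin : ∀ n : ℕ, {a : List ι | a.length = n ∧ AI a ≠ 0}.Finite)

-- With at least two sources, strip the chain at the root. The amplitude is bounded by a finite sum
-- of products of a chain amplitude, summable by hypothesis, and a forest amplitude, summable by
-- induction since the forest has at least two trees.
include hfin in
theorem summable_norm_treeTerm {G : ι → ι → 𝕜}
    (hsum : ∀ x y : ι, Summable fun T => ‖treeTerm G AI x [y] T‖) (x : ι) (w : List ι) :
    Summable fun T => ‖treeTerm G AI x w T‖ := by
  induction hn : w.length using Nat.strong_induction_on generalizing x w with
  | _ n ih =>
    match w, hn with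
    | [], _ =>
      simp only [treeTerm_nil, norm_zero]
      exact summable_zero
    | [y], _ => exact hsum x y
    | y :: z :: w, hn =>
      set W := y :: z :: w with hW
      have hWl : 2 ≤ W.length := by simp [hW]
      set S := ((finite_vertex hfin W.length).subset
        (t := {p : ι × List ι | 2 ≤ p.2.length ∧ p.2.length ≤ W.length ∧ AI (p.1 :: p.2) ≠ 0})
        fun p hp => hp.2).toFinset with hSdef
      choose s hs using exists_chain
      -- A summable bound over all pairs (chain length, forest) restricts to trees along this
      -- injection.
      have hsinj : Function.Injective s := fun T T' h => by rw [← (hs T).1, h, (hs T').1]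
      have hb : Summable fun q : ℕ × List PTree => ∑ p ∈ S,
          ‖treeTerm G AI x [p.1] (chain q.1 leaf)‖ *
            (‖AI (p.1 :: p.2)‖ * ‖forestTerm G AI p.2 W q.2‖) := by
        refine summable_sum fun p hp => ?_
        rw [hSdef, Set.Finite.mem_toFinset] at hp
        refine Summable.mul_of_nonneg (f := fun m => ‖treeTerm G AI x [p.1] (chain m leaf)‖)
          (g := fun us => ‖AI (p.1 :: p.2)‖ * ‖forestTerm G AI p.2 W us‖)
          ((hsum x p.1).comp_injective chain_leaf_injective) ?_
          (fun _ => norm_nonneg _) fun _ => by positivity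
        refine (summable_norm_forestTerm G AI p.2 W fun a v hv => ?_).mul_left _
        exact ih v.length (by have := hp.1; omega) a v rfl
      refine Summable.of_nonneg_of_le (fun _ => norm_nonneg _) (fun T => ?_)
        (hb.comp_injective hsinj)
      simp only [Function.comp_def]
      obtain ⟨h1, h2⟩ := hs T
      -- A pure chain has one leaf and so does not match the two or more sources.
      by_cases h0 : (s T).2 = []
      · have hT : numLeaves T = 1 := by
          rw [← h1, h0, numLeaves_chain]
          exact numLeaves_leaf
        rw [treeTerm, if_neg (by omega), norm_zero]
        positivity
      · conv_lhs => rw [← h1]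
        rw [treeTerm_chain G hfin h0 W (S := S)]
        · refine (norm_sum_le _ _).trans (Finset.sum_le_sum fun p _ => ?_)
          rw [mul_assoc]
          exact (norm_mul_le _ _).trans
            (mul_le_mul_of_nonneg_left (norm_mul_le _ _) (norm_nonneg _))
        · intro p hp hp'
          rw [hSdef, Set.Finite.mem_toFinset]
          have h3 : p.2.length = (s T).2.length := by
            by_contra h
            exact hp' (forestTerm_of_length_ne G AI h W)
          have h4 : ¬ W.length < p.2.length := fun h => hp' (forestTerm_of_lt G AI h _)
          have h5 := List.length_pos_iff.2 h0
          exact ⟨by omega, by omega, hp⟩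

-- The Dyson equation.

theorem field_nil {W : PlanarSeries ι 𝕜} (hW : ∀ x, W [x] = 0) (x : ι) : field W x [] = 0 := hW x

/-- Without tadpoles each field starts in degree one, so a product of `k` fields starts in degree
`k`. This makes every coefficient of Γ[Φ] a finite sum. -/
theorem fieldProd_of_lt {W : PlanarSeries ι 𝕜} (hW : ∀ x, W [x] = 0) {as w : List ι}
    (h : w.length < as.length) : fieldProd W as w = 0 := by
  induction as generalizing w with
  | nil => simp at h
  | cons a as ih =>
    rw [fieldProd]
    cases w with
    | nil => exact (mul_nil _ _).trans (by rw [field_nil hW, zero_mul])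
    | cons i w =>
      rw [mul_apply]
      refine Finset.sum_eq_zero fun n hn => ?_
      cases n with
      | zero => rw [List.take_zero, field_nil hW, zero_mul]
      | succ n =>
        rw [ih, mul_zero]
        simp only [List.length_cons, List.drop_succ_cons, List.length_drop] at h ⊢
        omega

theorem Gam_apply (W : PlanarSeries ι 𝕜) (a w : List ι) :
    Gam AI W a w = ∑ᶠ is, AI (a ++ is) * fieldProd W is w :=
  finsum_congr fun _ => const_mul_apply _ _ _

variable [CompleteSpace 𝕜]

/-- By absolute convergence the sum over forests is a Cauchy product of sums over trees, and each of
these is a coefficient of a field. -/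
theorem tsum_forestTerm {G : ι → ι → 𝕜}
    (hsum : ∀ x w, Summable fun T => ‖treeTerm G AI x w T‖) (as w : List ι) :
    ∑' ts, forestTerm G AI as w ts = fieldProd (connectedW G AI) as w := by
  induction as generalizing w with
  | nil =>
    simp only [forestTerm_nil]
    exact tsum_ite_eq [] fun _ => const 1 w
  | cons a as ih =>
    rw [← cons_pair_injective.tsum_eq]
    · simp only [forestTerm_cons_cons]
      have hs := fun v => summable_norm_forestTerm G AI as v fun a v _ => hsum a v
      rw [Summable.tsum_finsetSum fun n _ =>
        summable_mul_of_summable_norm (hsum a _) (hs _)]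
      simp only [fieldProd, mul_apply]
      refine Finset.sum_congr rfl fun n _ => ?_
      rw [← tsum_mul_tsum_of_summable_norm (hsum a _) (hs _), ih, ← connectedW_cons]
      rfl
    · intro ts hts
      by_contra h
      rw [nil_of_notMem_range_cons h] at hts
      exact hts (forestTerm_of_length_ne G AI (by simp) w)

-- Cut each tree at its root: it is a single vertex, or a line to a vertex whose children form an
-- arbitrary non-empty forest. Summing over the forests turns the legs into fields.
include hfin in
theorem connectedW_dyson {G : ι → ι → 𝕜}
    (hsum : ∀ x w, Summable fun T => ‖treeTerm G AI x w T‖) (x : ι) {w : List ι} (hw : w ≠ []) :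
    connectedW G AI (x :: w) =
      leafAmp G x w + ∑ᶠ z : ι, G x z * Gam AI (connectedW G AI) [z] w := by
  have h1 : ∀ p : ι × List ι, AI (p.1 :: p.2) * fieldProd (connectedW G AI) p.2 w ≠ 0 →
      p.2.length ≤ w.length ∧ AI (p.1 :: p.2) ≠ 0 := fun p hp => by
    refine ⟨?_, left_ne_zero_of_mul hp⟩
    by_contra h
    exact right_ne_zero_of_mul hp (fieldProd_of_lt (connectedW_singleton G AI) (by omega))
  have h2 : (∑ᶠ z : ι, G x z * Gam AI (connectedW G AI) [z] w) =
      ∑ᶠ p : ι × List ι, G x p.1 * (AI (p.1 :: p.2) * fieldProd (connectedW G AI) p.2 w) := by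
    rw [finsum_curry]
    · refine finsum_congr fun z => ?_
      rw [Gam_apply, mul_finsum']
      · rfl
      · exact Set.Finite.preimage (f := fun is => (z, is)) (fun _ _ _ _ h => by simpa using h)
          (hasFiniteSupport_vertex hfin w.length h1)
    · exact hasFiniteSupport_vertex hfin w.length fun p hp => h1 p (right_ne_zero_of_mul hp)
  set S := ((finite_vertex hfin w.length).subset
    (t := {p : ι × List ι | 1 ≤ p.2.length ∧ p.2.length ≤ w.length ∧ AI (p.1 :: p.2) ≠ 0})
    fun p hp => hp.2).toFinset with hS
  have h3 : ∀ ts, treeTerm G AI x w (node ts) = (if ts = [] then leafAmp G x w else 0) +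
      ∑ p ∈ S, G x p.1 * AI (p.1 :: p.2) * forestTerm G AI p.2 w ts := by
    intro ts
    by_cases h : ts = []
    · rw [if_pos h, h, Finset.sum_eq_zero, add_zero]
      · exact treeTerm_leaf G AI x w
      · intro p hp
        rw [hS, Set.Finite.mem_toFinset] at hp
        rw [forestTerm_of_length_ne G AI (by have := hp.1; simp only [List.length_nil]; omega),
          mul_zero]
    · rw [if_neg h, zero_add]
      refine treeTerm_node G hfin h x w fun p hp hp' => ?_
      rw [hS, Set.Finite.mem_toFinset]
      have h3 : p.2.length = ts.length := by
        by_contra h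
        exact hp' (forestTerm_of_length_ne G AI h w)
      have h4 : ¬ w.length < p.2.length := fun h => hp' (forestTerm_of_lt G AI h _)
      have h5 := List.length_pos_iff.2 h
      exact ⟨by omega, by omega, hp⟩
  have h4 : ∀ p ∈ S, Summable fun ts => G x p.1 * AI (p.1 :: p.2) * forestTerm G AI p.2 w ts :=
    fun p _ => (summable_norm_forestTerm G AI p.2 w fun a v _ => hsum a v).of_norm.mul_left _
  have hbij : Function.Bijective PTree.node :=
    ⟨fun _ _ h => PTree.node.inj h, fun ⟨ts⟩ => ⟨ts, rfl⟩⟩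
  rw [connectedW_cons, ← (Equiv.ofBijective _ hbij).tsum_eq, h2]
  simp only [Equiv.ofBijective_apply, h3]
  rw [Summable.tsum_add _ (summable_sum h4), tsum_ite_eq [] (fun _ => leafAmp G x w), Summable.tsum_finsetSum h4]
  · congr 1
    rw [finsum_eq_sum_of_support_subset (s := S)]
    · refine Finset.sum_congr rfl fun p _ => ?_
      rw [← mul_assoc, ← tsum_forestTerm hsum]
      exact (summable_norm_forestTerm G AI p.2 w fun a v _ => hsum a v).of_norm.tsum_mul_left _
    · intro p hp
      rw [Finset.mem_coe, hS, Set.Finite.mem_toFinset]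
      have h5 := right_ne_zero_of_mul hp
      refine ⟨?_, h1 p h5⟩
      -- The empty word of legs, which no tree realises, would contribute the tadpole `AI [z]`; it
      -- drops out because `w` is non-empty.
      by_contra h
      have h6 : p.2 = [] := List.length_eq_zero_iff.1 (by omega)
      apply right_ne_zero_of_mul h5
      rw [h6]
      cases w with
      | nil => exact absurd rfl hw
      | cons i w => rfl
  · exact (hasSum_ite_eq [] (leafAmp G x w)).summable

end Summability

theorem exists_ne_zero_of_finsum_ne_zero {α M : Type*} [AddCommMonoid M] {f : α → M}
    (h : ∑ᶠ a, f a ≠ 0) : ∃ a, f a ≠ 0 := by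
  by_contra! h'
  exact h (by simp only [h', finsum_zero])

namespace PlanarSeries

variable {α β : Type*} [CommSemiring 𝕜]

theorem LocFin.mul_mul {f : α → PlanarSeries ι 𝕜} {h : β → PlanarSeries ι 𝕜} (hf : LocFin f)
    (hh : LocFin h) (g : α × β → PlanarSeries ι 𝕜) :
    LocFin fun p : α × β => f p.1 * (g p * h p.2) := by
  intro w
  have h1 := (Finset.range (w.length + 1)).finite_toSet.biUnion fun n _ =>
    (hf (w.take n)).prod ((Finset.range ((w.drop n).length + 1)).finite_toSet.biUnion fun m _ =>
      hh ((w.drop n).drop m))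
  refine h1.subset fun p hp => ?_
  obtain ⟨n, hn, hp⟩ := Finset.exists_ne_zero_of_sum_ne_zero (f := fun n =>
    f p.1 (w.take n) * (g p * h p.2) (w.drop n)) hp
  obtain ⟨m, hm, hp'⟩ := Finset.exists_ne_zero_of_sum_ne_zero (f := fun m =>
    g p ((w.drop n).take m) * h p.2 ((w.drop n).drop m)) (right_ne_zero_of_mul hp)
  exact Set.mem_biUnion (Finset.mem_coe.2 hn) ⟨left_ne_zero_of_mul hp,
    Set.mem_biUnion (Finset.mem_coe.2 hm) (right_ne_zero_of_mul hp')⟩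

theorem LocFin.sumOver {f : α × β → PlanarSeries ι 𝕜} (hf : LocFin f) :
    LocFin fun a => sumOver fun b => f (a, b) := by
  intro w
  refine ((hf w).image Prod.fst).subset fun a ha => ?_
  obtain ⟨b, hb⟩ := exists_ne_zero_of_finsum_ne_zero (f := fun b => f (a, b) w) ha
  exact ⟨(a, b), hb, rfl⟩

end PlanarSeries

-- Planar derivatives of vertex functions and of the full propagator.

section Identities

theorem derivs_pair_apply (W : PlanarSeries ι 𝕜) (x y : ι) (w : List ι) :
    W.derivs [x, y] w = W (x :: y :: w) := rfl

theorem deriv_field [NormedCommRing 𝕜] (W : PlanarSeries ι 𝕜) (x y : ι) :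
    PlanarSeries.deriv y (field W x) = W.derivs [x, y] := rfl

variable [NormedCommRing 𝕜] {AI : List ι → 𝕜} {W : PlanarSeries ι 𝕜}

theorem Gam_nil (hW : ∀ x, W [x] = 0) (a : List ι) : Gam AI W a [] = AI a := by
  rw [Gam_apply, finsum_eq_single _ []]
  · simp only [List.append_nil, fieldProd, one_apply, const_nil, mul_one]
  · intro is his
    rw [fieldProd_of_lt hW (w := []) (List.length_pos_iff.2 his), mul_zero]

/-- The Leibniz term that would differentiate later fields carries the constant coefficient of the
first field, which is zero. -/
theorem deriv_fieldProd_cons (hW : ∀ x, W [x] = 0) (i b : ι) (is : List ι) :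
    PlanarSeries.deriv i (fieldProd W (b :: is)) = W.derivs [b, i] * fieldProd W is := by
  rw [fieldProd, PlanarSeries.deriv_mul, field_nil hW, const_zero, zero_mul, zero_add, deriv_field]

variable (hfin : ∀ n : ℕ, {a : List ι | a.length = n ∧ AI a ≠ 0}.Finite)

include hfin in
theorem finite_vertex_le (n : ℕ) : {a : List ι | a.length ≤ n ∧ AI a ≠ 0}.Finite := by
  refine ((Finset.range (n + 1)).finite_toSet.biUnion fun m _ => hfin m).subset ?_
  rintro a ⟨h1, h2⟩
  exact Set.mem_biUnion (Finset.mem_coe.2 (Finset.mem_range.2 (by omega))) ⟨rfl, h2⟩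

include hfin in
theorem locFin_const_mul {α : Type*} {e : α → List ι} (he : Function.Injective e)
    {A : α → PlanarSeries ι 𝕜} {c : ℕ} (hA : ∀ p w, A p w ≠ 0 → (e p).length ≤ c + w.length) :
    LocFin fun p => const (AI (e p)) * A p := by
  intro w
  refine ((finite_vertex_le hfin (c + w.length)).preimage he.injOn).subset fun p hp => ?_
  have hp : (const (AI (e p)) * A p : PlanarSeries ι 𝕜) w ≠ 0 := hp
  rw [const_mul_apply] at hp
  exact ⟨hA p w (right_ne_zero_of_mul hp), left_ne_zero_of_mul hp⟩

-- If the coefficient is non-zero, `a` is a prefix of a word with non-zero `AI` that is at most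
-- `w.length` letters longer, and there are finitely many such words.
include hfin in
theorem finite_Gam (hW : ∀ x, W [x] = 0) (r : ℕ) (w : List ι) :
    {a : List ι | a.length ≤ r ∧ Gam AI W a w ≠ 0}.Finite := by
  refine ((((finite_vertex_le hfin (r + w.length)).prod
    (Finset.range (r + 1)).finite_toSet)).image fun q : List ι × ℕ => q.1.take q.2).subset ?_
  rintro a ⟨h1, h2⟩
  rw [Gam_apply] at h2
  obtain ⟨is, h⟩ := exists_ne_zero_of_finsum_ne_zero h2
  refine ⟨(a ++ is, a.length), ⟨⟨?_, left_ne_zero_of_mul h⟩, ?_⟩, by simp⟩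
  · have : ¬ w.length < is.length := fun h' => right_ne_zero_of_mul h (fieldProd_of_lt hW h')
    simp only [List.length_append]
    omega
  · exact Finset.mem_coe.2 (Finset.mem_range.2 (by simp only; omega))

include hfin in
theorem locFin_mul_Gam (hW : ∀ x, W [x] = 0) {α : Type*} {e : α → List ι}
    (he : Function.Injective e) {r : ℕ} {F : α → PlanarSeries ι 𝕜}
    (hF : ∀ p, r < (e p).length → F p = 0) : LocFin fun p => F p * Gam AI W (e p) := by
  have h1 : LocFin fun p => if (e p).length ≤ r then Gam AI W (e p) else 0 := by
    intro w
    refine ((finite_Gam hfin hW r w).preimage he.injOn).subset fun p hp => ?_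
    by_cases h : (e p).length ≤ r
    · refine ⟨h, ?_⟩
      simpa only [Function.mem_support, if_pos h] using hp
    · exact absurd (by simp only [if_neg h, PlanarSeries.zero_apply]) hp
  have h2 := h1.mul_left F
  convert h2 using 2 with p
  split_ifs with h
  · rfl
  · rw [hF p (by omega), zero_mul, zero_mul]

include hfin in
theorem locFin_Gam (hW : ∀ x, W [x] = 0) {α : Type*} {e : α → List ι}
    (he : Function.Injective e) {r : ℕ} (hr : ∀ p, (e p).length ≤ r) :
    LocFin fun p => Gam AI W (e p) := by
  have h := locFin_mul_Gam hfin hW he (r := r) (F := fun _ => 1)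
    fun p hp => absurd (hr p) (by omega)
  simpa only [one_mul] using h

include hfin in
/-- The planar derivative of a vertex function attaches a new leg on the right. -/
theorem deriv_Gam (hW : ∀ x, W [x] = 0) (i : ι) (a : List ι) :
    PlanarSeries.deriv i (Gam AI W a) =
      sumOver fun b => W.derivs [b, i] * Gam AI W (a ++ [b]) := by
  have hle : ∀ (is w : List ι), fieldProd W is w ≠ 0 → is.length ≤ w.length := fun is w h => by
    by_contra h'
    exact h (fieldProd_of_lt hW (by omega))
  have hinj : Function.Injective fun p : ι × List ι => p.1 :: p.2 := by
    rintro ⟨b, is⟩ ⟨c, js⟩ h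
    simpa using h
  have h1 : ∀ b, Gam AI W (a ++ [b]) =
      sumOver fun is => const (AI (a ++ b :: is)) * fieldProd W is := fun b => by
    simp only [Gam, List.append_assoc, List.singleton_append]
  have h2 : LocFin fun p : ι × List ι =>
      W.derivs [p.1, i] * (const (AI (a ++ p.1 :: p.2)) * fieldProd W p.2) := by
    refine LocFin.mul_left (locFin_const_mul hfin (e := fun p : ι × List ι => a ++ p.1 :: p.2)
      (c := a.length + 1) (fun p q h => hinj (List.append_cancel_left h)) fun p w h => ?_) _
    have := hle _ _ h
    simp only [List.length_append, List.length_cons]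
    omega
  -- The empty word gives a constant, killed by the derivative; each remaining word is written `b ::
  -- is`, and `b` becomes the new leg.
  rw [Gam, deriv_sumOver, sumOver_comp_injective hinj]
  · simp only [PlanarSeries.deriv_const_mul, deriv_fieldProd_cons hW, h1]
    have h3 : ∀ b, W.derivs [b, i] * (sumOver fun is => const (AI (a ++ b :: is)) * fieldProd W is) =
        sumOver fun is => W.derivs [b, i] * (const (AI (a ++ b :: is)) * fieldProd W is) := by
      refine fun b => mul_sumOver (locFin_const_mul hfin (c := a.length + 1)
        (fun p q h => ?_) fun is w h => ?_) _
      · simpa using h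
      · have := hle _ _ h
        simp only [List.length_append, List.length_cons]
        omega
    simp only [h3]
    rw [sumOver_curry h2]
    congr 1
    funext p
    rw [← mul_assoc, ← mul_const_comm, mul_assoc]
  · intro is his
    cases is with
    | nil => rw [PlanarSeries.deriv_const_mul]; exact mul_zero _
    | cons b is => exact absurd ⟨(b, is), rfl⟩ his

/-- The insertion of a propagator and of a two-point vertex at the root of a family of series. -/
def insertion (G : ι → ι → 𝕜) (AI : List ι → 𝕜) (W : PlanarSeries ι 𝕜)
    (X : ι → PlanarSeries ι 𝕜) (x : ι) : PlanarSeries ι 𝕜 :=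
  sumOver fun p : ι × ι => const (G x p.1) * (X p.2 * Gam AI W [p.1, p.2])

theorem pair_injective : Function.Injective fun p : ι × ι => [p.1, p.2] := by
  rintro ⟨a, b⟩ ⟨c, d⟩ h
  simpa using h

include hfin in
theorem locFin_insertion (hW : ∀ x, W [x] = 0) (G : ι → ι → 𝕜) (X : ι → PlanarSeries ι 𝕜) (x : ι) :
    LocFin fun p : ι × ι => const (G x p.1) * (X p.2 * Gam AI W [p.1, p.2]) :=
  ((locFin_Gam hfin hW pair_injective (r := 2) fun _ => le_rfl).mul_left _).mul_left _

-- This is the derivative of the Dyson equation in `y`, with `deriv_Gam` applied to the one-leg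
-- function Γ_z.
include hfin in
theorem derivs_pair_dyson (hW : ∀ x, W [x] = 0) {G : ι → ι → 𝕜}
    (hdyson : ∀ (x : ι) (w : List ι), w ≠ [] →
      W (x :: w) = leafAmp G x w + ∑ᶠ z : ι, G x z * Gam AI W [z] w) (x y : ι) :
    W.derivs [x, y] = const (G x y) + insertion G AI W (fun c => W.derivs [c, y]) x := by
  have h1 : W.derivs [x, y] = const (G x y) +
      sumOver fun z => const (G x z) * PlanarSeries.deriv y (Gam AI W [z]) := by
    ext w
    rw [derivs_pair_apply, hdyson x (y :: w) (by simp), PlanarSeries.add_apply, sumOver_apply]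
    simp only [const_mul_apply]
    cases w <;> rfl
  have h2 : ∀ z : ι, const (G x z) * (sumOver fun b => W.derivs [b, y] * Gam AI W ([z] ++ [b])) =
      sumOver fun b => const (G x z) * (W.derivs [b, y] * Gam AI W [z, b]) := fun z =>
    mul_sumOver ((locFin_Gam hfin hW (e := fun b => [z, b]) (fun p q h => by simpa using h) (r := 2)
      fun _ => le_rfl).mul_left _) _
  rw [h1, insertion]
  simp only [deriv_Gam hfin hW, h2]
  rw [sumOver_curry (locFin_insertion hfin hW G (fun b => W.derivs [b, y]) x)]

/-- Separates the only term that involves `X` at the full word `w` from those at shorter words, so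
that uniqueness can be proved by induction on length. -/
theorem insertion_apply (hW : ∀ x, W [x] = 0) (G : ι → ι → 𝕜) (X : ι → PlanarSeries ι 𝕜) (x : ι)
    (w : List ι) : insertion G AI W X x w = ∑ᶠ p : ι × ι, G x p.1 *
      (∑ n ∈ Finset.range w.length, X p.2 (w.take n) * Gam AI W [p.1, p.2] (w.drop n) +
        X p.2 w * AI [p.1, p.2]) := by
  rw [insertion, sumOver_apply]
  refine finsum_congr fun p => ?_
  rw [const_mul_apply, mul_apply, Finset.sum_range_succ, List.take_length, List.drop_length,
    Gam_nil hW]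

include hfin in
/-- The only fixed point of the insertion of a two-point vertex is zero. -/
theorem eq_zero_of_insertion_eq {G : ι → ι → 𝕜}
    (hsum : ∀ x y : ι, Summable fun T => ‖treeTerm G AI x [y] T‖) {Y : ι → 𝕜}
    {Q : Finset (ι × ι)} (hQ : ∀ p : ι × ι, AI [p.1, p.2] ≠ 0 → p ∈ Q)
    (hY : ∀ x, Y x = ∑ p ∈ Q, G x p.1 * AI [p.1, p.2] * Y p.2) (x : ι) : Y x = 0 := by
  -- Iterating the equation `m` more times replaces the line `G` by the chain with `m` two-point
  -- insertions.
  have h1 : ∀ m x, Y x =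
      ∑ p ∈ Q, treeTerm G AI x [p.1] (chain m leaf) * AI [p.1, p.2] * Y p.2 := by
    intro m
    induction m with
    | zero =>
      simp only [chain, treeTerm_leaf, leafAmp]
      exact hY
    | succ m ih =>
      intro x
      rw [hY x]
      conv_lhs => enter [2, p]; rw [ih p.2]
      simp only [chain, treeTerm_unary G hfin _ x _ hQ, Finset.mul_sum, Finset.sum_mul]
      rw [Finset.sum_comm]
      exact Finset.sum_congr rfl fun p _ => Finset.sum_congr rfl fun q _ => by ring
  have h2 : Filter.Tendsto (fun m => ∑ p ∈ Q,
      treeTerm G AI x [p.1] (chain m leaf) * AI [p.1, p.2] * Y p.2) Filter.atTop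
      (nhds (∑ p ∈ Q, 0 * AI [p.1, p.2] * Y p.2)) := by
    refine tendsto_finsetSum _ fun p _ => ?_
    refine (Filter.Tendsto.mul_const _ ?_).mul_const _
    have h3 := ((hsum x p.1).comp_injective chain_leaf_injective).tendsto_atTop_zero
    exact tendsto_zero_iff_norm_tendsto_zero.2 h3
  simp only [zero_mul, Finset.sum_const_zero] at h2
  exact tendsto_nhds_unique (tendsto_const_nhds.congr fun m => h1 m x) h2

-- If the solutions agree on shorter words, the source `S` and all lower terms cancel in the
-- difference, which then solves the homogeneous equation for coefficients at `w`.
include hfin in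
theorem eq_of_add_insertion_eq (hW : ∀ x, W [x] = 0) {G : ι → ι → 𝕜}
    (hsum : ∀ x y : ι, Summable fun T => ‖treeTerm G AI x [y] T‖) {S X X' : ι → PlanarSeries ι 𝕜}
    (hX : ∀ x, X x = S x + insertion G AI W X x)
    (hX' : ∀ x, X' x = S x + insertion G AI W X' x) : X = X' := by
  have hQ : {p : ι × ι | AI [p.1, p.2] ≠ 0}.Finite :=
    ((finite_vertex_le hfin 2).preimage pair_injective.injOn).subset fun p hp => ⟨le_rfl, hp⟩
  have hsupp : ∀ (X : ι → PlanarSeries ι 𝕜) (x : ι) (w : List ι),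
      Function.HasFiniteSupport fun p : ι × ι => G x p.1 *
      (∑ n ∈ Finset.range w.length, X p.2 (w.take n) * Gam AI W [p.1, p.2] (w.drop n) +
        X p.2 w * AI [p.1, p.2]) := fun X x w => by
    have h := locFin_insertion hfin hW G X x w
    simp only [const_mul_apply] at h
    simpa only [mul_apply, Finset.sum_range_succ, List.take_length,
      List.drop_length, Gam_nil hW] using h
  suffices h : ∀ (n : ℕ) (w : List ι), w.length = n → ∀ x, X x w - X' x w = 0 by
    funext x
    ext w
    exact sub_eq_zero.1 (h _ w rfl x)
  intro n
  induction n using Nat.strong_induction_on with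
  | _ n ih =>
  intro w hw
  refine eq_zero_of_insertion_eq hfin hsum (Q := hQ.toFinset) (by simp) fun x => ?_
  rw [hX x, hX' x, PlanarSeries.add_apply, PlanarSeries.add_apply, add_sub_add_left_eq_sub, insertion_apply hW,
    insertion_apply hW, ← finsum_sub_distrib (hsupp X x w) (hsupp X' x w)]
  have h1 : ∀ p : ι × ι,
      ∑ n ∈ Finset.range w.length, X p.2 (w.take n) * Gam AI W [p.1, p.2] (w.drop n) =
      ∑ n ∈ Finset.range w.length, X' p.2 (w.take n) * Gam AI W [p.1, p.2] (w.drop n) := by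
    refine fun p => Finset.sum_congr rfl fun m hm => ?_
    rw [Finset.mem_range] at hm
    rw [sub_eq_zero.1 (ih m (by omega) (w.take m) (by rw [List.length_take]; omega) p.2)]
  refine Eq.trans (finsum_congr fun p => ?_) (finsum_eq_sum_of_support_subset
    (fun p : ι × ι => G x p.1 * AI [p.1, p.2] * (X p.2 w - X' p.2 w)) fun p hp => ?_)
  · rw [h1 p]
    ring
  · rw [Finset.mem_coe, Set.Finite.mem_toFinset]
    exact right_ne_zero_of_mul (left_ne_zero_of_mul hp)

/-- The vertex, with index `z` towards the root, that joins a `c`-number subtree `s` on the left and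
the new leaf with source `i` on the right. -/
def cherryVertex (AI : List ι → 𝕜) (W : PlanarSeries ι 𝕜) (s : ι → 𝕜) (i z : ι) :
    PlanarSeries ι 𝕜 :=
  sumOver fun q : ι × ι => const (s q.1) * W.derivs [q.2, i] * Gam AI W [z, q.1, q.2]

/-- The product along the rightmost branch for the new leaf with source `i` grafted at the root, to
the right of the `c`-number subtree `s`. -/
def cherry (AI : List ι → 𝕜) (W : PlanarSeries ι 𝕜) (s : ι → 𝕜) (i x : ι) : PlanarSeries ι 𝕜 :=
  sumOver fun z => cherryVertex AI W s i z * W.derivs [x, z]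

include hfin in
theorem locFin_cherryVertex_family (hW : ∀ x, W [x] = 0) (s : ι → 𝕜) (i : ι) :
    LocFin fun p : ι × ι × ι =>
      const (s p.2.1) * W.derivs [p.2.2, i] * Gam AI W [p.1, p.2.1, p.2.2] := by
  refine (locFin_Gam hfin hW (e := fun p : ι × ι × ι => [p.1, p.2.1, p.2.2]) ?_ (r := 3)
    fun _ => le_rfl).mul_left _
  rintro ⟨a, b, c⟩ ⟨d, e, f⟩ h
  simpa using h

include hfin in
theorem locFin_cherryVertex (hW : ∀ x, W [x] = 0) (s : ι → 𝕜) (i : ι) :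
    LocFin (cherryVertex AI W s i) :=
  (locFin_cherryVertex_family hfin hW s i).sumOver

include hfin in
theorem sumOver_const_mul_deriv_Gam (hW : ∀ x, W [x] = 0) (s : ι → 𝕜) (i z : ι) :
    (sumOver fun c => const (s c) * PlanarSeries.deriv i (Gam AI W [z, c])) =
      cherryVertex AI W s i z := by
  have hl := (locFin_cherryVertex_family hfin hW s i).comp (g := fun q : ι × ι => (z, q))
    fun p q h => by simpa using h
  have h : ∀ c : ι, const (s c) * (sumOver fun b => W.derivs [b, i] * Gam AI W ([z, c] ++ [b])) =
      sumOver fun b => const (s c) * W.derivs [b, i] * Gam AI W [z, c, b] := fun c => by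
    rw [mul_sumOver]
    · simp only [mul_assoc, List.cons_append, List.nil_append]
    · exact (locFin_Gam hfin hW (e := fun b => [z, c] ++ [b]) (fun p q h => by simpa using h)
        (r := 3) fun _ => le_rfl).mul_left _
  simp only [deriv_Gam hfin hW, h]
  exact sumOver_curry hl

-- By the Leibniz rule the derivative of the insertion falls on Γ, with W_{cy} reduced to its
-- constant coefficient, or on W_{cy}. The former is the source term, the latter is again an
-- insertion.
include hfin in
theorem deriv_derivs_pair_eq (hW : ∀ x, W [x] = 0) {G : ι → ι → 𝕜}
    (hdyson : ∀ x y, W.derivs [x, y] =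
      const (G x y) + insertion G AI W (fun c => W.derivs [c, y]) x) (x y i : ι) :
    PlanarSeries.deriv i (W.derivs [x, y]) =
      (sumOver fun z => const (G x z) *
        cherryVertex AI W (fun c => W.derivs [c, y] []) i z) +
      insertion G AI W (fun c => PlanarSeries.deriv i (W.derivs [c, y])) x := by
  have h1 : ∀ p : ι × ι, PlanarSeries.deriv i
      (const (G x p.1) * (W.derivs [p.2, y] * Gam AI W [p.1, p.2])) =
      const (G x p.1) *
        (const (W.derivs [p.2, y] []) * PlanarSeries.deriv i (Gam AI W [p.1, p.2])) +
      const (G x p.1) * (PlanarSeries.deriv i (W.derivs [p.2, y]) * Gam AI W [p.1, p.2]) := by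
    intro p
    rw [PlanarSeries.deriv_const_mul, PlanarSeries.deriv_mul, mul_add]
  have h2 := (((locFin_Gam hfin hW (pair_injective (ι := ι)) (r := 2) fun _ => le_rfl).deriv
    i).mul_left fun p => const (W.derivs [p.2, y] [])).mul_left fun p => const (G x p.1)
  have h3 : ∀ z : ι, const (G x z) * cherryVertex AI W (fun c => W.derivs [c, y] []) i z =
      sumOver fun c => const (G x z) *
        (const (W.derivs [c, y] []) * PlanarSeries.deriv i (Gam AI W [z, c])) := by
    intro z
    rw [← sumOver_const_mul_deriv_Gam hfin hW, mul_sumOver]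
    exact ((locFin_Gam hfin hW (e := fun c => [z, c]) (fun p q h => by simpa using h) (r := 2)
      fun _ => le_rfl).deriv i).mul_left _
  conv_lhs => rw [hdyson x y, PlanarSeries.deriv_add, PlanarSeries.deriv_const, zero_add, insertion, deriv_sumOver]
  simp only [h1]
  rw [sumOver_add h2 (locFin_insertion hfin hW G
    (fun c => PlanarSeries.deriv i (W.derivs [c, y])) x), insertion]
  simp only [h3]
  rw [sumOver_curry h2]

-- Expand the last factor W_{xz} by its Dyson equation: the bare line gives the source term, and the
-- insertion, standing at the root end, acts on the whole product. This is the equation satisfied by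
-- ∂_i W_{xy} when `s` is W_{cy}[0].
include hfin in
theorem cherry_eq (hW : ∀ x, W [x] = 0) {G : ι → ι → 𝕜}
    (hdyson : ∀ x y, W.derivs [x, y] =
      const (G x y) + insertion G AI W (fun c => W.derivs [c, y]) x) (s : ι → 𝕜) (i x : ι) :
    cherry AI W s i x = (sumOver fun z => const (G x z) * cherryVertex AI W s i z) +
      insertion G AI W (cherry AI W s i) x := by
  have hB := locFin_cherryVertex hfin hW s i
  have hl := hB.mul_mul (locFin_Gam hfin hW (pair_injective (ι := ι)) (r := 2) fun _ => le_rfl)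
    fun q => const (G x q.2.1) * W.derivs [q.2.2, q.1]
  have h1 : ∀ z, cherryVertex AI W s i z * W.derivs [x, z] =
      const (G x z) * cherryVertex AI W s i z +
        sumOver fun p : ι × ι => cherryVertex AI W s i z *
          (const (G x p.1) * W.derivs [p.2, z] * Gam AI W [p.1, p.2]) := by
    intro z
    rw [hdyson x z, mul_add, mul_const_comm, insertion,
      mul_sumOver (locFin_insertion hfin hW G (fun c => W.derivs [c, z]) x)]
    simp only [mul_assoc]
  have h2 : ∀ p : ι × ι, const (G x p.1) * (cherry AI W s i p.2 * Gam AI W [p.1, p.2]) =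
      sumOver fun z => cherryVertex AI W s i z *
          (const (G x p.1) * W.derivs [p.2, z] * Gam AI W [p.1, p.2]) := by
    intro p
    rw [cherry, sumOver_mul (hB.mul_right _), mul_sumOver ((hB.mul_right _).mul_right _)]
    congr 1
    funext z
    simp only [← mul_assoc, mul_const_comm]
  rw [cherry]
  simp only [h1]
  rw [sumOver_add (hB.mul_left _) hl.sumOver, insertion]
  simp only [h2]
  rw [sumOver_comm hl]

include hfin in
/-- The planar derivative of the full propagator grafts a new leaf to it. -/
theorem deriv_derivs_pair (hW : ∀ x, W [x] = 0) {G : ι → ι → 𝕜}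
    (hsum : ∀ x y : ι, Summable fun T => ‖treeTerm G AI x [y] T‖)
    (hdyson : ∀ x y, W.derivs [x, y] =
      const (G x y) + insertion G AI W (fun c => W.derivs [c, y]) x) (x y i : ι) :
    PlanarSeries.deriv i (W.derivs [x, y]) = cherry AI W (fun c => W.derivs [c, y] []) i x := by
  have h := eq_of_add_insertion_eq hfin hW hsum
    (fun x => deriv_derivs_pair_eq hfin hW hdyson x y i)
    (fun x => cherry_eq hfin hW hdyson (fun c => W.derivs [c, y] []) i x)
  exact congrFun h x

end Identities

-- The derivative of the rule F_γ.

section Rule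

variable [NormedCommRing 𝕜] {AI : List ι → 𝕜} {W : PlanarSeries ι 𝕜}

theorem FgammaForest_cons (t : PTree) {us : List PTree} (hus : us ≠ []) (a : ι) (as w : List ι) :
    FgammaForest AI W (t :: us) (a :: as) w =
      const (shadowAmp AI W t a (w.take t.numLeaves)) *
        FgammaForest AI W us as (w.drop t.numLeaves) := by
  cases us with
  | nil => exact absurd rfl hus
  | cons u us => rw [FgammaForest]

theorem FgammaForest_of_length_ne {ts : List PTree} {as : List ι} (h : as.length ≠ ts.length)
    (w : List ι) : FgammaForest AI W ts as w = 0 := by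
  induction ts generalizing as w with
  | nil =>
    cases as with
    | nil => exact absurd rfl h
    | cons a as => rw [FgammaForest, const_zero] <;> simp
  | cons t ts ih =>
    cases as with
    | nil => rw [FgammaForest, const_zero] <;> simp
    | cons a as =>
      cases ts with
      | nil =>
        cases as with
        | nil => exact absurd rfl h
        | cons b as => rw [FgammaForest, const_zero] <;> simp
      | cons u ts => rw [FgammaForest_cons t (by simp), ih (by simpa using h), mul_zero]

variable (hfin : ∀ n : ℕ, {a : List ι | a.length = n ∧ AI a ≠ 0}.Finite) (hW : ∀ x, W [x] = 0)

theorem vertex_injective : Function.Injective fun p : ι × List ι => p.1 :: p.2 := by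
  rintro ⟨b, is⟩ ⟨c, js⟩ h
  simpa using h

include hfin hW in
theorem locFin_node {F : List ι → PlanarSeries ι 𝕜} {r : ℕ} (hF : ∀ as, r < as.length → F as = 0)
    (x : ι) : LocFin fun p : ι × List ι => F p.2 * Gam AI W (p.1 :: p.2) * W.derivs [x, p.1] :=
  (locFin_mul_Gam hfin hW vertex_injective (r := r + 1) (F := fun p : ι × List ι => F p.2)
    fun p hp => hF p.2 (by simpa using hp)).mul_right _

include hfin hW in
theorem Fgamma_node {ts : List PTree} (hts : ts ≠ []) (x : ι) (w : List ι) :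
    Fgamma AI W (node ts) x w = sumOver fun p : ι × List ι =>
      FgammaForest AI W ts p.2 w * Gam AI W (p.1 :: p.2) * W.derivs [x, p.1] := by
  cases ts with
  | nil => exact absurd rfl hts
  | cons t ts =>
    rw [Fgamma]
    exact sumOver_curry (locFin_node hfin hW (F := fun as => FgammaForest AI W (t :: ts) as w)
      (r := (t :: ts).length) (fun as h => FgammaForest_of_length_ne (by omega) w) x)

theorem Fgamma_leaf (x y : ι) : Fgamma AI W leaf x [y] = W.derivs [x, y] := by
  rw [leaf, Fgamma]

/-- The `c`-number part of the Feynman rule for a forest. -/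
def shadowForestAmp (AI : List ι → 𝕜) (W : PlanarSeries ι 𝕜) :
    List PTree → List ι → List ι → 𝕜 :=
  forestAmp (fun x y => (W.derivs [x, y]).atZero) (fun a => (Gam AI W a).atZero)

theorem shadowForestAmp_nil_nil (w : List ι) : shadowForestAmp AI W [] [] w = 1 := by
  rw [shadowForestAmp, forestAmp]

theorem shadowForestAmp_cons (t : PTree) (ts : List PTree) (a : ι) (as w : List ι) :
    shadowForestAmp AI W (t :: ts) (a :: as) w =
      shadowAmp AI W t a (w.take t.numLeaves) *
        shadowForestAmp AI W ts as (w.drop t.numLeaves) := by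
  rw [shadowForestAmp, forestAmp, shadowAmp]

theorem shadowForestAmp_of_length_ne {ts : List PTree} {as : List ι} (h : as.length ≠ ts.length)
    (w : List ι) : shadowForestAmp AI W ts as w = 0 :=
  forestAmp_of_length_ne _ _ h w

theorem shadowAmp_leaf (x y : ι) : shadowAmp AI W leaf x [y] = W.derivs [x, y] [] := by
  rw [shadowAmp, leaf, treeAmp]
  rfl

include hfin hW in
theorem shadowAmp_node {ts : List PTree} (hts : ts ≠ []) (x : ι) (w : List ι) :
    shadowAmp AI W (node ts) x w = ∑ᶠ p : ι × List ι,
      W.derivs [x, p.1] [] * AI (p.1 :: p.2) * shadowForestAmp AI W ts p.2 w := by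
  have h : (fun a => (Gam AI W a).atZero) = AI := funext fun a => Gam_nil hW a
  rw [shadowAmp, shadowForestAmp, h]
  exact treeAmp_node _ hfin hts x w

-- At zero sources the factors of the branch become the same commuting numbers as those off the
-- branch. Hence the constants left by the Leibniz rule are exactly the factors of a subtree that
-- has left the rightmost branch.
mutual
theorem Fgamma_nil
    (hfin : ∀ n : ℕ, {a : List ι | a.length = n ∧ AI a ≠ 0}.Finite) (hW : ∀ x, W [x] = 0) : ∀ (T : PTree) (x : ι) (w : List ι), w.length = numLeaves T →
    Fgamma AI W T x w [] = shadowAmp AI W T x w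
  | node [], x, w, h => by
      rw [numLeaves] at h
      obtain ⟨y, rfl⟩ := List.length_eq_one_iff.1 h
      exact (congrFun (Fgamma_leaf x y) []).trans (shadowAmp_leaf x y).symm
  | node (t :: ts), x, w, h => by
      rw [numLeaves_node (by simp)] at h
      rw [Fgamma_node hfin hW (by simp), shadowAmp_node hfin hW (by simp), sumOver_apply]
      refine finsum_congr fun p => ?_
      rw [mul_nil, mul_nil, Gam_nil hW, FgammaForest_nil hfin hW (t :: ts) p.2 w (by simp) h]
      ring
theorem FgammaForest_nil
    (hfin : ∀ n : ℕ, {a : List ι | a.length = n ∧ AI a ≠ 0}.Finite) (hW : ∀ x, W [x] = 0) : ∀ (ts : List PTree) (as w : List ι), ts ≠ [] →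
    w.length = numLeavesForest ts → FgammaForest AI W ts as w [] = shadowForestAmp AI W ts as w
  | [], _, _, h, _ => absurd rfl h
  | [t], as, w, _, h => by
      rw [numLeavesForest, numLeavesForest, add_zero] at h
      match as with
      | [] => rw [FgammaForest_of_length_ne (by simp), shadowForestAmp_of_length_ne (by simp)]; rfl
      | [a] =>
        rw [FgammaForest, shadowForestAmp_cons, shadowForestAmp_nil_nil, mul_one, ← h,
          List.take_length]
        exact Fgamma_nil hfin hW t a w h
      | a :: b :: as =>
        rw [FgammaForest_of_length_ne (by simp), shadowForestAmp_of_length_ne (by simp)]; rfl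
  | t :: u :: ts, as, w, _, h => by
      rw [numLeavesForest] at h
      cases as with
      | nil =>
        rw [FgammaForest_of_length_ne (by simp), shadowForestAmp_of_length_ne (by simp)]; rfl
      | cons a as =>
        rw [FgammaForest, const_mul_apply, shadowForestAmp_cons,
          FgammaForest_nil hfin hW (u :: ts) as (w.drop t.numLeaves) (by simp)
            (by rw [List.length_drop]; omega)]
end

/-- The new leaf takes over the rightmost branch, so all of `ts` contributes numbers only. -/
theorem FgammaForest_append_leaf {ts : List PTree} {w : List ι} (hw : w.length = numLeavesForest ts)
    (as : List ι) (b i : ι) : FgammaForest AI W (ts ++ [leaf]) (as ++ [b]) (w ++ [i]) =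
      const (shadowForestAmp AI W ts as w) * W.derivs [b, i] := by
  induction ts generalizing as w with
  | nil =>
    rw [numLeavesForest] at hw
    rw [List.length_eq_zero_iff.1 hw]
    cases as with
    | nil =>
      rw [shadowForestAmp_nil_nil]
      simp only [List.nil_append]
      rw [FgammaForest, Fgamma_leaf]
      exact (one_mul _).symm
    | cons a as =>
      rw [FgammaForest_of_length_ne (by simp), shadowForestAmp_of_length_ne (by simp), const_zero,
        zero_mul]
  | cons t ts ih =>
    rw [numLeavesForest] at hw
    cases as with
    | nil =>
      rw [FgammaForest_of_length_ne (by simp), shadowForestAmp_of_length_ne (by simp), const_zero,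
        zero_mul]
    | cons a as =>
      rw [List.cons_append, List.cons_append, FgammaForest_cons t (by simp), shadowForestAmp_cons,
        List.take_append_of_le_length (by omega), List.drop_append_of_le_length (by omega),
        ih (by rw [List.length_drop]; omega), ← mul_assoc, const_mul_const]

include hfin hW in
theorem locFin_cherry (i x : ι) : LocFin fun q : ι × ι × ι =>
    W.derivs [q.2.2, i] * Gam AI W [q.1, q.2.1, q.2.2] * W.derivs [x, q.1] := by
  refine ((locFin_Gam hfin hW (e := fun p : ι × ι × ι => [p.1, p.2.1, p.2.2]) ?_ (r := 3)
    fun _ => le_rfl).mul_left _).mul_right _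
  rintro ⟨a, b, c⟩ ⟨d, e, f⟩ h
  simpa using h

include hfin hW in
theorem cherry_eq_sumOver (s : ι → 𝕜) (i x : ι) : cherry AI W s i x =
    sumOver fun q : ι × ι × ι => const (s q.2.1) *
      (W.derivs [q.2.2, i] * Gam AI W [q.1, q.2.1, q.2.2] * W.derivs [x, q.1]) := by
  have hl := locFin_cherryVertex_family hfin hW s i
  have h : ∀ z, cherryVertex AI W s i z * W.derivs [x, z] = sumOver fun q : ι × ι =>
      const (s q.1) * (W.derivs [q.2, i] * Gam AI W [z, q.1, q.2] * W.derivs [x, z]) := by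
    intro z
    rw [cherryVertex, sumOver_mul (hl.comp (g := fun q : ι × ι => (z, q))
      fun p q h => by simpa using h)]
    simp only [mul_assoc]
  rw [cherry]
  simp only [h]
  exact sumOver_curry ((locFin_cherry hfin hW i x).mul_left _)

theorem sumOver_const {α : Type*} (c : α → 𝕜) :
    (sumOver fun a => const (c a)) = (const (∑ᶠ a, c a) : PlanarSeries ι 𝕜) := by
  ext w
  cases w with
  | nil => rfl
  | cons i w => exact finsum_zero

-- Linearity of `cherry` in the left subtree; it reassembles the amplitude of the old tree from the
-- summands at its root.
include hfin hW in
theorem sumOver_const_mul_cherry {α : Type*} {c : α → 𝕜} (hc : Function.HasFiniteSupport c)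
    (s : α → ι → 𝕜) (i x : ι) : (sumOver fun p => const (c p) * cherry AI W (s p) i x) =
      cherry AI W (fun a => ∑ᶠ p, c p * s p a) i x := by
  have hl := locFin_cherry hfin hW i x
  have hc' := locFin_const (ι := ι) hc
  simp only [cherry_eq_sumOver hfin hW, ← sumOver_const]
  have h1 : ∀ p, const (c p) * (sumOver fun q : ι × ι × ι => const (s p q.2.1) *
      (W.derivs [q.2.2, i] * Gam AI W [q.1, q.2.1, q.2.2] * W.derivs [x, q.1])) =
      sumOver fun q : ι × ι × ι => const (c p) * (const (s p q.2.1) *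
        (W.derivs [q.2.2, i] * Gam AI W [q.1, q.2.1, q.2.2] * W.derivs [x, q.1])) :=
    fun p => mul_sumOver (hl.mul_left _) _
  have h2 : ∀ q : ι × ι × ι, (sumOver fun p => const (c p * s p q.2.1)) *
      (W.derivs [q.2.2, i] * Gam AI W [q.1, q.2.1, q.2.2] * W.derivs [x, q.1]) =
      sumOver fun p => const (c p) * (const (s p q.2.1) *
        (W.derivs [q.2.2, i] * Gam AI W [q.1, q.2.1, q.2.2] * W.derivs [x, q.1])) := fun q => by
    simp only [← const_mul_const]
    rw [sumOver_mul (hc'.mul_right _)]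
    simp only [mul_assoc]
  simp only [h1, h2]
  exact sumOver_comm (hc'.mul_mul hl fun y => const (s y.1 y.2.2.1))

include hfin hW in
/-- A new root whose children are the old root and the new leaf. -/
theorem Fgamma_pair_leaf (T : PTree) (x : ι) {w : List ι} (hw : w.length = numLeaves T) (i : ι) :
    Fgamma AI W (node [T, leaf]) x (w ++ [i]) =
      cherry AI W (fun a => shadowAmp AI W T a w) i x := by
  have he : Function.Injective fun q : ι × ι × ι => (q.1, [q.2.1, q.2.2]) := by
    rintro ⟨a, b, c⟩ ⟨d, e, f⟩ h
    simpa using h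
  rw [Fgamma_node hfin hW (by simp), cherry_eq_sumOver hfin hW, sumOver_comp_injective he]
  · congr 1
    funext q
    have h := FgammaForest_append_leaf (AI := AI) (W := W) (ts := [T]) (w := w)
      (by simp only [numLeavesForest, hw, add_zero]) [q.2.1] q.2.2 i
    simp only [List.cons_append, List.nil_append] at h
    rw [h, shadowForestAmp_cons, shadowForestAmp_nil_nil, mul_one, ← hw, List.take_length]
    simp only [mul_assoc]
  · rintro ⟨z, as⟩ h
    rw [FgammaForest_of_length_ne, zero_mul, zero_mul]
    intro h'
    obtain ⟨a, b, rfl⟩ := List.length_eq_two.1 h'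
    exact h ⟨(z, a, b), rfl⟩

include hfin hW in
/-- A new rightmost child of the root. -/
theorem Fgamma_append_leaf (ts : List PTree) (x : ι) {w : List ι}
    (hw : w.length = numLeavesForest ts) (i : ι) :
    Fgamma AI W (node (ts ++ [leaf])) x (w ++ [i]) = sumOver fun p : ι × List ι =>
      const (shadowForestAmp AI W ts p.2 w) *
        PlanarSeries.deriv i (Gam AI W (p.1 :: p.2)) * W.derivs [x, p.1] := by
  have he : Function.Injective fun q : (ι × List ι) × ι => (q.1.1, q.1.2 ++ [q.2]) := by
    rintro ⟨⟨a, as⟩, b⟩ ⟨⟨c, cs⟩, d⟩ h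
    obtain ⟨rfl, h⟩ := Prod.mk.inj h
    obtain ⟨rfl, h⟩ := List.append_inj' h rfl
    simpa using h
  have hl := (locFin_node hfin hW (r := (ts ++ [leaf]).length)
    (F := fun as => FgammaForest AI W (ts ++ [leaf]) as (w ++ [i]))
    (fun as h => FgammaForest_of_length_ne (by omega) (w ++ [i])) x).comp he
  have h1 : ∀ p : ι × List ι, const (shadowForestAmp AI W ts p.2 w) *
      PlanarSeries.deriv i (Gam AI W (p.1 :: p.2)) * W.derivs [x, p.1] =
      sumOver fun b => FgammaForest AI W (ts ++ [leaf]) (p.2 ++ [b]) (w ++ [i]) *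
        Gam AI W (p.1 :: (p.2 ++ [b])) * W.derivs [x, p.1] := by
    intro p
    have hb : LocFin fun b => W.derivs [b, i] * Gam AI W (p.1 :: p.2 ++ [b]) :=
      (locFin_Gam hfin hW (e := fun b => p.1 :: p.2 ++ [b]) (fun a b h => by simpa using h)
        (r := p.2.length + 2) fun b => by simp).mul_left _
    rw [deriv_Gam hfin hW, mul_sumOver hb, sumOver_mul (hb.mul_left _)]
    simp only [FgammaForest_append_leaf hw, mul_assoc, List.cons_append]
  simp only [h1]
  rw [Fgamma_node hfin hW (by simp), sumOver_comp_injective he]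
  · exact (sumOver_curry (f := fun (p : ι × List ι) b =>
      FgammaForest AI W (ts ++ [leaf]) (p.2 ++ [b]) (w ++ [i]) *
        Gam AI W (p.1 :: (p.2 ++ [b])) * W.derivs [x, p.1]) hl).symm
  rintro ⟨z, as⟩ h
  rcases List.eq_nil_or_concat as with rfl | ⟨as, b, rfl⟩
  · rw [FgammaForest_of_length_ne, zero_mul, zero_mul]
    simp
  · exact absurd ⟨((z, as), b), by simp⟩ h

-- The three terms are the Leibniz terms for forest · Γ · W. Hitting W splits the line at the root,
-- and the constants in front sum to the old tree's number, giving the new root; hitting Γ adds a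
-- child to the root; the derivative of the forest is left for the recursion.
include hfin hW in
theorem deriv_Fgamma_node
    (hprop : ∀ x y i : ι, PlanarSeries.deriv i (W.derivs [x, y]) =
      cherry AI W (fun c => W.derivs [c, y] []) i x)
    {ts : List PTree} (hts : ts ≠ []) (x : ι) {w : List ι} (hw : w.length = numLeavesForest ts)
    (i : ι) : PlanarSeries.deriv i (Fgamma AI W (node ts) x w) =
      Fgamma AI W (node [node ts, leaf]) x (w ++ [i]) +
        Fgamma AI W (node (ts ++ [leaf])) x (w ++ [i]) +
        sumOver fun p : ι × List ι => PlanarSeries.deriv i (FgammaForest AI W ts p.2 w) *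
          Gam AI W (p.1 :: p.2) * W.derivs [x, p.1] := by
  have h1 : ∀ p : ι × List ι, PlanarSeries.deriv i
      (FgammaForest AI W ts p.2 w * Gam AI W (p.1 :: p.2) * W.derivs [x, p.1]) =
      const (shadowForestAmp AI W ts p.2 w * AI (p.1 :: p.2)) *
          cherry AI W (fun c => W.derivs [c, p.1] []) i x +
        const (shadowForestAmp AI W ts p.2 w) *
          PlanarSeries.deriv i (Gam AI W (p.1 :: p.2)) * W.derivs [x, p.1] +
        PlanarSeries.deriv i (FgammaForest AI W ts p.2 w) *
          Gam AI W (p.1 :: p.2) * W.derivs [x, p.1] := by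
    intro p
    rw [PlanarSeries.deriv_mul, PlanarSeries.deriv_mul, mul_nil, Gam_nil hW, hprop, add_mul,
      FgammaForest_nil hfin hW ts p.2 w hts hw, add_assoc]
  have hc : Function.HasFiniteSupport fun p : ι × List ι =>
      shadowForestAmp AI W ts p.2 w * AI (p.1 :: p.2) := by
    refine hasFiniteSupport_vertex hfin ts.length fun p hp => ⟨le_of_eq ?_, right_ne_zero_of_mul hp⟩
    by_contra h
    exact left_ne_zero_of_mul hp (shadowForestAmp_of_length_ne h w)
  have hA := (locFin_const (ι := ι) hc).mul_right
    fun p => cherry AI W (fun c => W.derivs [c, p.1] []) i x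
  have hB : LocFin fun p : ι × List ι => const (shadowForestAmp AI W ts p.2 w) *
      PlanarSeries.deriv i (Gam AI W (p.1 :: p.2)) * W.derivs [x, p.1] := by
    refine LocFin.mul_right ?_ _
    simp only [← PlanarSeries.deriv_const_mul]
    refine (locFin_mul_Gam hfin hW vertex_injective (r := ts.length + 1) fun p hp => ?_).deriv i
    rw [shadowForestAmp_of_length_ne (by simp only [List.length_cons] at hp; omega), const_zero]
  have hC := locFin_node hfin hW (r := ts.length)
    (F := fun as => PlanarSeries.deriv i (FgammaForest AI W ts as w))
    (fun as h => by rw [FgammaForest_of_length_ne (by omega), PlanarSeries.deriv_zero]) x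
  rw [Fgamma_node hfin hW hts, deriv_sumOver]
  simp only [h1]
  rw [sumOver_add (hA.add hB) hC, sumOver_add hA hB, sumOver_const_mul_cherry hfin hW hc,
    Fgamma_pair_leaf hfin hW _ _ (by rw [numLeaves_node hts, hw]),
    Fgamma_append_leaf hfin hW _ _ hw]
  congr 3
  funext a
  rw [shadowAmp_node hfin hW hts]
  exact finsum_congr fun p => by ring

mutual
/-- The planar derivative of the Feynman rule `F_γ` is `F_γ` of the right-growth. -/
theorem deriv_Fgamma
    (hfin : ∀ n : ℕ, {a : List ι | a.length = n ∧ AI a ≠ 0}.Finite) (hW : ∀ x, W [x] = 0)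
    (hprop : ∀ x y i : ι, PlanarSeries.deriv i (W.derivs [x, y]) =
      cherry AI W (fun c => W.derivs [c, y] []) i x) (i : ι) :
    ∀ (T : PTree) (x : ι) (w : List ι), w.length = numLeaves T →
      PlanarSeries.deriv i (Fgamma AI W T x w) =
        ((growth T).map fun T' => Fgamma AI W T' x (w ++ [i])).sum
  | node [], x, w, h => by
      have h' := h
      rw [numLeaves] at h'
      obtain ⟨y, rfl⟩ := List.length_eq_one_iff.1 h'
      simp only [growth, Multiset.map_singleton, Multiset.sum_singleton]
      rw [Fgamma_pair_leaf hfin hW leaf x h]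
      simp only [shadowAmp_leaf]
      rw [← hprop, Fgamma]
  | node (t :: ts), x, w, h => by
      rw [numLeaves_node (by simp)] at h
      rw [deriv_Fgamma_node hfin hW hprop (by simp) x h]
      simp only [growth, Multiset.map_add, Multiset.sum_add, Multiset.map_singleton,
        Multiset.sum_singleton, Multiset.map_map, Function.comp_def]
      congr 1
      have h1 := fun us (hus : us ∈ growthLast (t :: ts)) =>
        Fgamma_node hfin hW (growthLast_ne_nil (by simp) hus) x (w ++ [i])
      rw [Multiset.map_congr rfl h1, ← sumOver_multiset_sum]
      · congr 1
        funext p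
        rw [deriv_FgammaForest hfin hW hprop i (t :: ts) p.2 w h, Multiset.sum_map_mul_right,
          Multiset.sum_map_mul_right]
      · intro us _
        exact locFin_node hfin hW (F := fun as => FgammaForest AI W us as (w ++ [i]))
          (r := us.length) (fun as h => FgammaForest_of_length_ne (by omega) _) x
theorem deriv_FgammaForest
    (hfin : ∀ n : ℕ, {a : List ι | a.length = n ∧ AI a ≠ 0}.Finite) (hW : ∀ x, W [x] = 0)
    (hprop : ∀ x y i : ι, PlanarSeries.deriv i (W.derivs [x, y]) =
      cherry AI W (fun c => W.derivs [c, y] []) i x) (i : ι) :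
    ∀ (ts : List PTree) (as w : List ι), w.length = numLeavesForest ts →
      PlanarSeries.deriv i (FgammaForest AI W ts as w) =
        ((growthLast ts).map fun us => FgammaForest AI W us as (w ++ [i])).sum
  | [], as, w, _ => by
      rw [growthLast, FgammaForest]
      · rfl
      · simp
      · simp
  | [t], as, w, h => by
      rw [numLeavesForest, numLeavesForest, add_zero] at h
      simp only [growthLast, Multiset.map_map, Function.comp_def]
      by_cases has : as.length = 1
      · obtain ⟨a, rfl⟩ := List.length_eq_one_iff.1 has
        simp only [FgammaForest]
        exact deriv_Fgamma hfin hW hprop i t a w h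
      · rw [FgammaForest_of_length_ne (by simpa using has), PlanarSeries.deriv_zero,
          Multiset.map_congr rfl fun T _ => FgammaForest_of_length_ne (by simpa using has) _]
        simp
  | t :: u :: ts, as, w, h => by
      rw [numLeavesForest] at h
      rw [growthLast, Multiset.map_map]
      simp only [Function.comp_def]
      cases as with
      | nil =>
        rw [FgammaForest_of_length_ne (by simp), PlanarSeries.deriv_zero,
          Multiset.map_congr rfl fun T _ => FgammaForest_of_length_ne (by simp) _]
        simp
      | cons a as =>
        have h1 := fun us (hus : us ∈ growthLast (u :: ts)) =>
          FgammaForest_cons (AI := AI) (W := W) t (growthLast_ne_nil (by simp) hus) a as (w ++ [i])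
        rw [Multiset.map_congr rfl h1, Multiset.sum_map_mul_left, FgammaForest,
          PlanarSeries.deriv_const_mul, deriv_FgammaForest hfin hW hprop i (u :: ts) as (w.drop t.numLeaves)
            (by rw [List.length_drop]; omega),
          List.take_append_of_le_length (by omega), List.drop_append_of_le_length (by omega)]
end

-- Induction on the sources, removing the last one since it is differentiated last. Each step
-- applies `deriv_Fgamma` to every tree, and `bind_growth_reducedTrees` collects the results.
include hfin hW in
theorem derivs_eq_sum_Fgamma
    (hprop : ∀ x y i : ι, PlanarSeries.deriv i (W.derivs [x, y]) =
      cherry AI W (fun c => W.derivs [c, y] []) i x) (x : ι) {w : List ι} (hw : w ≠ []) :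
    W.derivs (x :: w) = ∑ T ∈ reducedTrees w.length, Fgamma AI W T x w := by
  induction w using List.reverseRecOn with
  | nil => exact absurd rfl hw
  | append_singleton w i ih =>
    by_cases h : w = []
    · subst h
      simp only [List.nil_append, List.length_singleton, reducedTrees_one, Finset.sum_singleton,
        Fgamma_leaf]
    · rw [← List.cons_append, derivs_append, ih h, List.length_append, List.length_singleton]
      refine (map_sum (derivHom i) _ _).trans ?_
      have h1 : ∀ T ∈ reducedTrees w.length, derivHom i (Fgamma AI W T x w) =
          ((growth T).map fun T' => Fgamma AI W T' x (w ++ [i])).sum := fun T hT =>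
        deriv_Fgamma hfin hW hprop i T x w (mem_reducedTrees.1 hT).2.symm
      rw [Finset.sum_congr rfl h1, Finset.sum_eq_multiset_sum, Finset.sum_eq_multiset_sum,
        ← bind_growth_reducedTrees (List.length_pos_iff.2 h), Multiset.map_bind,
        Multiset.sum_bind]

end Rule

end PlanarQFT

end

-- Assembly of the theorem.

theorem mainTheorem3 {ι 𝕜 : Type*} [NormedCommRing 𝕜] [CompleteSpace 𝕜]
    (G : ι → ι → 𝕜) (AI : List ι → 𝕜)
    (hfin : ∀ n : ℕ, {a : List ι | a.length = n ∧ AI a ≠ 0}.Finite)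
    (hsum : ∀ x y : ι, Summable fun T : {T : PlanarQFT.PTree // T.numLeaves = 1} =>
      ‖PlanarQFT.treeAmp G AI T.1 x [y]‖) :
    -- the series that define the connected Green's functions converge absolutely
    (∀ (x : ι) (w : List ι),
      Summable fun T : {T : PlanarQFT.PTree // T.numLeaves = w.length} =>
        ‖PlanarQFT.treeAmp G AI T.1 x w‖) ∧
    -- the functional derivatives of `W[j]` are sums over reduced trees
    (∀ (x : ι) (w : List ι), w ≠ [] →
      (PlanarQFT.connectedW G AI).derivs (x :: w) =
        ∑ T ∈ PlanarQFT.PTree.reducedTrees w.length,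
          PlanarQFT.Fgamma AI (PlanarQFT.connectedW G AI) T x w) ∧
    -- a further derivative of `F_γ(T)` is the sum of `F_γ` over the right-growth of `T`
    (∀ (x : ι) (w : List ι) (i : ι), ∀ T ∈ PlanarQFT.PTree.reducedTrees w.length,
      PlanarQFT.PlanarSeries.deriv i (PlanarQFT.Fgamma AI (PlanarQFT.connectedW G AI) T x w) =
        (T.growth.map fun T' =>
          PlanarQFT.Fgamma AI (PlanarQFT.connectedW G AI) T' x (w ++ [i])).sum) ∧
    -- right-growth creates each reduced tree with one more leaf exactly once
    (∀ n : ℕ, 1 ≤ n →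
      (PlanarQFT.PTree.reducedTrees n).val.bind PlanarQFT.PTree.growth =
        (PlanarQFT.PTree.reducedTrees (n + 1)).val) := by
  have hsum1 : ∀ x y : ι, Summable fun T => ‖PlanarQFT.treeTerm G AI x [y] T‖ := fun x y =>
    (PlanarQFT.summable_subtype_treeTerm_iff G AI x [y]).1 (hsum x y)
  have hsum' := PlanarQFT.summable_norm_treeTerm hfin hsum1
  have hW := PlanarQFT.connectedW_singleton G AI
  have hprop := PlanarQFT.deriv_derivs_pair hfin hW hsum1 (PlanarQFT.derivs_pair_dyson hfin hW
    fun x w hw => PlanarQFT.connectedW_dyson hfin hsum' x hw)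
  refine ⟨fun x w => (PlanarQFT.summable_subtype_treeTerm_iff G AI x w).2 (hsum' x w),
    fun x w hw => PlanarQFT.derivs_eq_sum_Fgamma hfin hW hprop x hw,
    fun x w i T hT => PlanarQFT.deriv_Fgamma hfin hW hprop i T x w
      (PlanarQFT.PTree.mem_reducedTrees.1 hT).2.symm,
    fun n hn => PlanarQFT.PTree.bind_growth_reducedTrees hn⟩
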